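/- \textbf{Theorem (random coding error).} Let $1\le n_R\le n_T$ and $l\ge 1$ be integers and consider the block channel $\mathbf Y=\mathbf H\mathbf X+\mathbf Z$ with $\mathbf X\in\mathbb R_+^{n_T\times l}$ and $\mathbf H\in\mathbb R_+^{n_R\times n_T}$, where $\mathbf Z\in\mathbb R^{n_R\times l}$ has i.i.d. $\mathcal N(0,\sigma_n^2)$ entries, $\sigma_n>0$ fixed. The matrix $\mathbf H$ is independent of $\mathbf X,\mathbf Z$ and known to the receiver; its entries are $h_{ij}=e^{-\nu d_{ij}}h^r_{ij}$ with fixed real $\nu,d_{ij}$ and i.i.d. $h^r_{ij}$ having on $(0,\infty)$ one of the densities $e^{-x}$ (negative exponential); $\frac{2(\rho_1\rho_2)^{(\rho_1+\rho_2)/2}}{\Gamma(\rho_1)\Gamma(\rho_2)}x^{\frac{\rho_1+\rho_2}{2}-1}K_{\rho_1-\rho_2}(2\sqrt{\rho_1\rho_2x})$ with $0<\rho_2<\rho_1$ and $K$ the modified Bessel function of the second kind (gamma-gamma); or $\frac{1}{x\sqrt{2\pi\sigma_l^2}}e^{-(\log x-\mu_l)^2/(2\sigma_l^2)}$ with $\sigma_l>0$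 (log-normal). The average power is $\mathcal E$, the peak power per transmitter is $\mathsf A=\mathcal E/\alpha$ with $\alpha\in(0,n_T/2]$ fixed, and $\rho=\mathsf{OSNR}=\mathcal E/\sigma_n$ tends to infinity. Let $r\ge0$ and let $R=r\log\rho$ (nats per channel use). Let $\mathrm P_{\rm out}(\rho)=\inf_p \mathrm P[I_p(\mathbf H)\le R]$, where $I_p(\mathrm H)$ is the mutual information between one input column $X\sim p$ and the corresponding output column $\mathrm HX+Z$, and the infimum is over all laws $p$ on $[0,\mathsf A]^{n_T}$ with $\mathbb E\|X\|_1\le\mathcal E$. Let the truncated exponential law on $[0,\mathsf A]$ have density $\frac1{\mathsf A}\frac{\mu}{1-e^{-\mu}}e^{-\mu x/\mathsf A}$, where $\frac1\mu-\frac{e^{-\mu}}{1-e^{-\mu}}=\frac{\alpha}{n_T}$ (for $\alpha=n_T/2$: $\mu=0$, the uniform law), and let $\mathcal C=\{\mathrm H: I_{\rm te}(\mathrm H)<R\}$ be the outage set of the input whose $n_T$ entries are i.i.d. with this law. Write the eigenvalues of $\mathbf H\mathbf H^{T}$ as $\lambda_i=\rho^{-a_i}$, $1\le i\le n_R$, let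 $f(a)$ denote the distribution of $a=(a_1,\dots,a_{n_R})$, and put $x^+=\max\{0,x\}$, \[ J(\rho)=\int_{\mathcal C^c} f(a)\,\rho^{-\frac l2\left(\sum_{i=1}^{n_R}(2-a_i)^+-2r\right)}\,da:=\mathbb E\Big[\mathbf 1_{\{\mathbf H\notin\mathcal C\}}\,\rho^{-\frac l2\left(\sum_{i=1}^{n_R}(2-a_i)^+-2r\right)}\Big]. \] Let $\mathrm P_{\rm e}(\rho)$ be the error probability, averaged over a uniform message, the channel, the noise and the code, of a random code with $\lceil\rho^{lr}\rceil$ codewords in $\mathbb R_+^{n_T\times l}$, all of whose entries are i.i.d. truncated exponential, under maximum-likelihood decoding with any tie-breaking rule. Then, with $\log 0=-\infty$, \[\limsup_{\rho\to\infty}\frac{\log \mathrm P_{\rm e}(\rho)}{\log\rho}\le\limsup_{\rho\to\infty}\frac{\log(\mathrm P_{\rm out}(\rho)+J(\rho))}{\log\rho}.\] In particular, whenever the limits (possibly $+\infty$) $d_{\rm out}(r)=-\lim_{\rho\to\infty}\frac{\log \mathrm P_{\rm out}(\rho)}{\log\rho}$ and $d_{\rm te}(r)=-\lim_{\rho\to\infty}\frac{\log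 J(\rho)}{\log\rho}$ exist, that is, $\mathrm P_{\rm out}(\rho)\doteq\rho^{-d_{\rm out}(r)}$ and $J(\rho)\doteq\rho^{-d_{\rm te}(r)}$, we have \[\mathrm P_{\rm e}(\rho)\ \dot\leqslant\ \rho^{-d_{\rm out}(r)}+\rho^{-d_{\rm te}(r)},\] where $F\,\dot\leqslant\,G$ means $\limsup_{\rho\to\infty}\frac{\log F(\rho)}{\log\rho}\le\liminf_{\rho\to\infty}\frac{\log G(\rho)}{\log\rho}$ (and $\rho^{-\infty}=0$). -/

import Mathlib

open MeasureTheory ProbabilityTheory Filter Topology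
open scoped NNReal ENNReal

namespace OWC

noncomputable section

/-- Modified Bessel function of the second kind `K_τ(x)`, for `x > 0`. -/
def besselK (τ x : ℝ) : ℝ :=
  ∫ t in Set.Ioi (0 : ℝ), Real.exp (-x * Real.cosh t) * Real.cosh (τ * t)

/-- The three models of the random atmospheric turbulence intensity. -/
inductive Turbulence where
  | negExp
  | gammaGamma (ρ₁ ρ₂ : ℝ) (pos : 0 < ρ₂) (lt : ρ₂ < ρ₁)
  | logNormal (μl σl : ℝ) (pos : 0 < σl)

/-- Density of the turbulence intensity on `(0, ∞)`. -/
def Turbulence.pdf : Turbulence → ℝ → ℝ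
  | .negExp, x => Real.exp (-x)
  | .gammaGamma ρ₁ ρ₂ _ _, x =>
      2 * (ρ₁ * ρ₂) ^ ((ρ₁ + ρ₂) / 2) / (Real.Gamma ρ₁ * Real.Gamma ρ₂)
        * x ^ ((ρ₁ + ρ₂) / 2 - 1) * besselK (ρ₁ - ρ₂) (2 * Real.sqrt (ρ₁ * ρ₂ * x))
  | .logNormal μl σl _, x =>
      1 / (x * Real.sqrt (2 * Real.pi * σl ^ 2))
        * Real.exp (-(Real.log x - μl) ^ 2 / (2 * σl ^ 2))

/-- Law of the turbulence intensity. -/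
def Turbulence.law (t : Turbulence) : Measure ℝ :=
  (volume.restrict (Set.Ioi 0)).withDensity fun x => ENNReal.ofReal (t.pdf x)

/-- The fixed parameters of the channel `Y = H X + Z` with `nT` transmitters and `nR` receivers:
turbulence model, attenuation parameter `ν`, distances `d i j`, noise standard deviation `σ`, and
ratio `α` of the average power to the peak power. -/
structure Channel (nR nT : ℕ) where
  turbulence : Turbulence
  ν : ℝ
  d : Fin nR → Fin nT → ℝ
  σ : ℝ≥0
  σ_pos : 0 < σ
  α : ℝ
  α_pos : 0 < α
  α_le : α ≤ (nT : ℝ) / 2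

variable {nR nT : ℕ}

/-- Law of the channel matrix `H`: independent entries `h i j = exp (-ν d i j) * hr i j`, the
`hr i j` being i.i.d. with the turbulence law. -/
def Channel.lawH (c : Channel nR nT) : Measure (Fin nR → Fin nT → ℝ) :=
  Measure.pi fun i => Measure.pi fun j =>
    c.turbulence.law.map fun x => Real.exp (-(c.ν * c.d i j)) * x

/-- Allowed total average power at optical signal-to-noise ratio `ρ` (which is `𝓔 / σ`). -/
def Channel.avgPower (c : Channel nR nT) (ρ : ℝ) : ℝ := ρ * c.σ

/-- Allowed peak power of each transmitter at optical signal-to-noise ratio `ρ`. -/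
def Channel.peak (c : Channel nR nT) (ρ : ℝ) : ℝ := c.avgPower ρ / c.α

/-- Law of an `nR × l` array of i.i.d. centred Gaussian noise samples of variance `σ ^ 2`. -/
def Channel.noise (c : Channel nR nT) (l : ℕ) : Measure (Fin nR → Fin l → ℝ) :=
  Measure.pi fun _ => Measure.pi fun _ => gaussianReal 0 (c.σ ^ 2)

/-- Law of the noise vector at one time index. -/
def Channel.noiseVec (c : Channel nR nT) : Measure (Fin nR → ℝ) :=
  Measure.pi fun _ => gaussianReal 0 (c.σ ^ 2)

/-- Input laws of one column satisfying nonnegativity and the peak- and average-power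
constraints. -/
structure Channel.Admissible (c : Channel nR nT) (ρ : ℝ) (p : Measure (Fin nT → ℝ)) : Prop where
  prob : IsProbabilityMeasure p
  peak : ∀ᵐ x ∂p, ∀ i, 0 ≤ x i ∧ x i ≤ c.peak ρ
  average : ∫ x, ∑ i, x i ∂p ≤ c.avgPower ρ

/-- Joint law of `(X, H X + Z)` at one time index, for a fixed channel matrix `H` and input
law `p`. -/
def Channel.jointXY (c : Channel nR nT) (p : Measure (Fin nT → ℝ)) (H : Fin nR → Fin nT → ℝ) :
    Measure ((Fin nT → ℝ) × (Fin nR → ℝ)) :=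
  (p.prod c.noiseVec).map fun xz => (xz.1, (Matrix.of H).mulVec xz.1 + xz.2)

/-- Mutual information `I(X; Y | H)` in nats, for a fixed channel matrix `H` and input law `p`. -/
def Channel.mutualInfo (c : Channel nR nT) (p : Measure (Fin nT → ℝ))
    (H : Fin nR → Fin nT → ℝ) : ℝ≥0∞ :=
  InformationTheory.klDiv (c.jointXY p H) ((c.jointXY p H).fst.prod (c.jointXY p H).snd)

/-- Target rate `R = r log ρ`, in nats per channel use. -/
def rate (r ρ : ℝ) : ℝ≥0∞ := ENNReal.ofReal (r * Real.log ρ)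

/-- Outage probability: the infimum, over all admissible input laws, of `P[I(X; Y | H) ≤ R]`. -/
def Channel.Pout (c : Channel nR nT) (r ρ : ℝ) : ℝ≥0∞ :=
  ⨅ (p : Measure (Fin nT → ℝ)) (_ : c.Admissible ρ p), c.lawH {H | c.mutualInfo p H ≤ rate r ρ}

/-- Mean of the truncated exponential law on `[0, 1]` with parameter `m`; the value `1 / 2` at
`m = 0` is the continuous extension (uniform law). -/
def truncExpMean (m : ℝ) : ℝ :=
  if m = 0 then 1 / 2 else 1 / m - Real.exp (-m) / (1 - Real.exp (-m))

/-- Density of the truncated exponential law on `[0, A]` with parameter `m` (uniform if `m = 0`). -/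
def truncExpPDF (A m x : ℝ) : ℝ :=
  1 / A * (if m = 0 then 1 else m / (1 - Real.exp (-m))) * Real.exp (-(m * x / A))

/-- The truncated exponential law on `[0, A]` with parameter `m`. -/
def truncExp (A m : ℝ) : Measure ℝ :=
  (volume.restrict (Set.Icc 0 A)).withDensity fun x => ENNReal.ofReal (truncExpPDF A m x)

/-- Input law of one column under truncated exponential coding. -/
def Channel.teInput (c : Channel nR nT) (m ρ : ℝ) : Measure (Fin nT → ℝ) :=
  Measure.pi fun _ => truncExp (c.peak ρ) m

/-- Outage set `𝓒` of the truncated exponential scheme. -/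
def Channel.outageSet (c : Channel nR nT) (m r ρ : ℝ) : Set (Fin nR → Fin nT → ℝ) :=
  {H | c.mutualInfo (c.teInput m ρ) H < rate r ρ}

/-- The eigenvalues of `H Hᵀ` (they enter below only through symmetric expressions, so that their
order is immaterial). -/
def eig (H : Fin nR → Fin nT → ℝ) : Fin nR → ℝ :=
  (Matrix.isHermitian_mul_conjTranspose_self (Matrix.of H)).eigenvalues

/-- The exponents `a i`, given by `λ i = ρ ^ (-a i)`. -/
def expo (ρ : ℝ) (H : Fin nR → Fin nT → ℝ) (i : Fin nR) : ℝ := -Real.logb ρ (eig H i)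

/-- `∫_{𝓒ᶜ} f(a) ρ ^ (-(l/2) (∑ (2 - a i)⁺ - 2 r)) da`. Since `f(a) da` is the law of the vector
`a = a(H)`, and `𝓒` is a set of channel matrices, this is the integral over `H ∉ 𝓒`. -/
def Channel.teIntegral (c : Channel nR nT) (l : ℕ) (m r ρ : ℝ) : ℝ≥0∞ :=
  ∫⁻ H in (c.outageSet m r ρ)ᶜ,
    ENNReal.ofReal (ρ ^ (-((l : ℝ) / 2) * (∑ i, max 0 (2 - expo ρ H i) - 2 * r))) ∂c.lawH

/-- Number of codewords of a code of block length `l` and rate `r log ρ`: `ρ ^ (l r)`, rounded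
up. -/
def codeSize (l : ℕ) (r ρ : ℝ) : ℕ := max 1 ⌈ρ ^ ((l : ℝ) * r)⌉₊

/-- Law of the random codebook: the entries of all the `nT × l` codewords are i.i.d. truncated
exponential. -/
def Channel.codebook (c : Channel nR nT) (l : ℕ) (m r ρ : ℝ) :
    Measure (Fin (codeSize l r ρ) → Fin nT → Fin l → ℝ) :=
  Measure.pi fun _ => Measure.pi fun _ => Measure.pi fun _ => truncExp (c.peak ρ) m

/-- The noiseless output `H X`. -/
def output {l : ℕ} (H : Fin nR → Fin nT → ℝ) (X : Fin nT → Fin l → ℝ) : Fin nR → Fin l → ℝ :=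
  fun i j => (Matrix.of H * Matrix.of X) i j

/-- Likelihood of the received block `Y` when `X` is sent and the channel matrix is `H`. -/
def Channel.likelihood (c : Channel nR nT) {l : ℕ} (H : Fin nR → Fin nT → ℝ)
    (X : Fin nT → Fin l → ℝ) (Y : Fin nR → Fin l → ℝ) : ℝ :=
  ∏ i, ∏ j, gaussianPDFReal (output H X i j) (c.σ ^ 2) (Y i j)

/-- A decoder for `M` messages, which knows the channel matrix, the codebook and the received
block. -/
abbrev Decoder (nR nT l M : ℕ) : Type :=
  (Fin nR → Fin nT → ℝ) → (Fin M → Fin nT → Fin l → ℝ) → (Fin nR → Fin l → ℝ) → Fin M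

/-- Maximum-likelihood decoders (ties may be broken in any way). -/
def Channel.IsML (c : Channel nR nT) {l M : ℕ} (δ : Decoder nR nT l M) : Prop :=
  ∀ (H : Fin nR → Fin nT → ℝ) (X : Fin M → Fin nT → Fin l → ℝ) (Y : Fin nR → Fin l → ℝ) (k : Fin M),
    c.likelihood H (X k) Y ≤ c.likelihood H (X (δ H X Y)) Y

/-- Average error probability of the random code, for a uniformly distributed message: average over
the message, the channel matrix, the random codebook and the noise. -/
def Channel.Pe (c : Channel nR nT) (l : ℕ) (m r ρ : ℝ)
    (δ : Decoder nR nT l (codeSize l r ρ)) : ℝ≥0∞ :=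
  (∑ k, (c.lawH.prod ((c.codebook l m r ρ).prod (c.noise l)))
    {ω | δ ω.1 ω.2.1 (output ω.1 (ω.2.1 k) + ω.2.2) ≠ k}) / (codeSize l r ρ : ℝ≥0∞)

/-- `log g(ρ) / log ρ`, where `log 0 = -∞`. -/
def exponent (g : ℝ → ℝ≥0∞) (ρ : ℝ) : EReal := ENNReal.log (g ρ) / (Real.log ρ : EReal)

/-- `ρ ^ e` for an extended real exponent `e`, with `ρ ^ (-∞) = 0`. -/
def osnrPow (ρ : ℝ) (e : EReal) : ℝ≥0∞ := EReal.exp (e * (Real.log ρ : EReal))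

/-- Exponential equality `g(ρ) ≐ ρ ^ b` as `ρ → ∞`. -/
def ExpEq (g : ℝ → ℝ≥0∞) (b : EReal) : Prop := Tendsto (exponent g) atTop (𝓝 b)

/-- Exponential inequality `f ⩽ g` to first order in the exponent, as `ρ → ∞` (for `g ≐ ρ ^ b` it says that
`limsup log f / log ρ ≤ b`). -/
def ExpLE (f g : ℝ → ℝ≥0∞) : Prop :=
  limsup (exponent f) atTop ≤ liminf (exponent g) atTop

end

end OWC

/-!
Up to bounded errors, both the mutual information of the truncated exponential input and the largest
mutual information of an admissible input equal `log det (1 + ρ² H Hᵀ) / 2`. The lower bound is the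
Donsker–Varadhan inequality for a Gaussian-shaped test function. For the upper bound, the inputs are
bounded by a multiple of `ρ`, so the output density given the input is at most a constant times
`det (1 + ρ² H Hᵀ) ^ (1 / 2)` times the output density of a Gaussian input of variance proportional
to `ρ²`.

Hence the outage set `𝓒` lies in the set `S` where the determinant is below `ρ ^ (2 r)` times a
constant `K`. That constant matters, since `P_out` involves the same set with a different constant,
and it is removed by a dilation: passing from `H` to `H / s` multiplies the determinant by a
constant factor or more, and changes the law of `H` by a subexponential factor only, up to a
negligible error.

On `S` the error probability is bounded by `1`. Off `S` the Bhattacharyya bound for two codewords is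
`∏ exp (-‖H (X k - X k')‖² / (8 σ²))`, and its average over the codewords, whose density is at most
a constant times a Gaussian one, is at most a constant times `det (1 + ρ² H Hᵀ) ^ (-l / 2)`. The
union bound over `ρ ^ (l r)` messages gives the integrand of `J`, because
`∏ (1 + ρ ^ 2 λ i) ≥ ρ ^ ∑ (2 - a i)⁺`.
-/

namespace OWC

open Matrix

section ProductMeasures

variable {ι : Type*} [Fintype ι] {E : ι → Type*} {mE : ∀ i, MeasurableSpace (E i)}

theorem lintegral_pi_prod {μ : ∀ i, Measure (E i)} [∀ i, SigmaFinite (μ i)]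
    {f : ∀ i, E i → ℝ≥0∞} (hf : ∀ i, Measurable (f i)) :
    ∫⁻ x, ∏ i, f i (x i) ∂(Measure.pi μ) = ∏ i, ∫⁻ x, f i x ∂(μ i) := by
  classical
  have hprod : ∀ s : Finset ι, Measurable fun x : ∀ i, E i => ∏ i ∈ s, f i (x i) := fun s =>
    Finset.measurable_prod _ fun i _ => (hf i).comp (measurable_pi_apply i)
  suffices h : ∀ (s : Finset ι) (x : ∀ i, E i),
      (∫⋯∫⁻_s, (fun x => ∏ i ∈ s, f i (x i)) ∂μ) x = ∏ i ∈ s, ∫⁻ y, f i y ∂(μ i) by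
    obtain hE | ⟨⟨x⟩⟩ := isEmpty_or_nonempty (∀ i, E i)
    · obtain ⟨i, hi⟩ := isEmpty_pi.1 hE
      rw [lintegral_of_isEmpty, Finset.prod_eq_zero (Finset.mem_univ i)]
      exact lintegral_of_isEmpty _ _
    · simpa using h Finset.univ x
  intro s
  induction s using Finset.induction_on with
  | empty => simp
  | insert i s his ih =>
    intro x
    have hupdate : ∀ (x : ∀ i, E i) (y : E i), ∏ j ∈ insert i s, f j (Function.update x i y j)
        = f i y * ∏ j ∈ s, f j (x j) := fun x y => by
      rw [Finset.prod_insert his, Function.update_self]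
      congr 1
      refine Finset.prod_congr rfl fun j hj => ?_
      rw [Function.update_of_ne (ne_of_mem_of_not_mem hj his)]
    rw [lmarginal_insert' _ (hprod _) his, Finset.prod_insert his, ← ih x]
    simp only [hupdate, lintegral_mul_const _ (hf i), lmarginal]
    exact lintegral_const_mul _ ((hprod s).comp measurable_updateFinset)

theorem pi_withDensity {μ : ∀ i, Measure (E i)} [∀ i, SigmaFinite (μ i)]
    {f : ∀ i, E i → ℝ≥0∞} (hf : ∀ i, Measurable (f i))
    [∀ i, SigmaFinite ((μ i).withDensity (f i))] :
    Measure.pi (fun i => (μ i).withDensity (f i))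
      = (Measure.pi μ).withDensity fun x => ∏ i, f i (x i) := by
  refine Measure.pi_eq fun s hs => ?_
  rw [withDensity_apply _ (.univ_pi hs), Measure.restrict_pi_pi, lintegral_pi_prod hf]
  exact Finset.prod_congr rfl fun i _ => (withDensity_apply _ (hs i)).symm

theorem pi_absolutelyContinuous {μ ν : ∀ i, Measure (E i)} [∀ i, SigmaFinite (μ i)]
    [∀ i, SigmaFinite (ν i)] (h : ∀ i, μ i ≪ ν i) : Measure.pi μ ≪ Measure.pi ν := by
  have hdensity : ∀ i, (ν i).withDensity ((μ i).rnDeriv (ν i)) = μ i := fun i =>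
    Measure.withDensity_rnDeriv_eq _ _ (h i)
  have : ∀ i, SigmaFinite ((ν i).withDensity ((μ i).rnDeriv (ν i))) := fun i => by
    rw [hdensity]; infer_instance
  have hpi := pi_withDensity (μ := ν) (f := fun i => (μ i).rnDeriv (ν i))
    fun i => Measure.measurable_rnDeriv _ _
  simp_rw [hdensity] at hpi
  rw [hpi]
  exact withDensity_absolutelyContinuous _ _

theorem pi_le_smul_pi {μ ν : ∀ i, Measure (E i)} [∀ i, SigmaFinite (μ i)] {c : ι → ℝ≥0}
    (hc : ∀ i, c i ≠ 0) (h : ∀ i, μ i ≤ c i • ν i) :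
    Measure.pi μ ≤ (∏ i, c i) • Measure.pi ν := by
  have h0 : ((∏ i, c i : ℝ≥0) : ℝ≥0∞) ≠ 0 := by
    simpa [Finset.prod_eq_zero_iff] using hc
  -- `Measure.pi ν` is built from the largest outer measure subject to bounds on boxes.
  have houter : ((∏ i, c i : ℝ≥0) : ℝ≥0∞)⁻¹ • (Measure.pi μ).toOuterMeasure
      ≤ OuterMeasure.pi fun i => (ν i).toOuterMeasure := by
    rw [OuterMeasure.le_pi]
    intro s _
    change ((∏ i, c i : ℝ≥0) : ℝ≥0∞)⁻¹ * Measure.pi μ (Set.univ.pi s) ≤ ∏ i, ν i (s i)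
    rw [Measure.pi_pi, ENNReal.inv_mul_le_iff h0 ENNReal.coe_ne_top, ENNReal.ofNNReal_finsetProd,
      ← Finset.prod_mul_distrib]
    exact Finset.prod_le_prod' fun i _ => h i (s i)
  refine Measure.le_iff.2 fun s _ => ?_
  calc Measure.pi μ s
      ≤ ((∏ i, c i : ℝ≥0) : ℝ≥0∞) * OuterMeasure.pi (fun i => (ν i).toOuterMeasure) s :=
        (ENNReal.inv_mul_le_iff h0 ENNReal.coe_ne_top).1 (houter s)
    _ ≤ ((∏ i, c i : ℝ≥0) : ℝ≥0∞) * Measure.pi ν s := by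
        rw [Measure.pi_def]
        gcongr
        exact le_toMeasure_apply _ _ _

theorem pi_restrict_le_smul_map {μ : ∀ i, Measure (E i)} [∀ i, SigmaFinite (μ i)]
    {f : ∀ i, E i → E i} (hf : ∀ i, Measurable (f i)) [∀ i, SigmaFinite ((μ i).map (f i))]
    {U : ∀ i, Set (E i)} {c : ι → ℝ≥0} (hc : ∀ i, c i ≠ 0)
    (h : ∀ i, (μ i).restrict (U i) ≤ c i • (μ i).map (f i)) :
    (Measure.pi μ).restrict (Set.univ.pi U)
      ≤ (∏ i, c i) • (Measure.pi μ).map fun x i => f i (x i) := by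
  rw [Measure.restrict_pi_pi, Measure.pi_map_pi fun i => (hf i).aemeasurable]
  exact pi_le_smul_pi hc h

theorem pi_exists_mem_le {E : Type*} [MeasurableSpace E] (μ : Measure E) [SigmaFinite μ]
    {W : Set E} (hW : MeasurableSet W) :
    Measure.pi (fun _ : ι => μ) {x | ∃ i, x i ∈ W}
      ≤ Fintype.card ι * (μ Set.univ ^ (Fintype.card ι - 1) * μ W) := by
  classical
  have hcoord : ∀ i, Measure.pi (fun _ : ι => μ) {x | x i ∈ W}
      = μ Set.univ ^ (Fintype.card ι - 1) * μ W := fun i => by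
    change Measure.pi (fun _ : ι => μ) (Function.eval i ⁻¹' W) = _
    rw [← Measure.map_apply (measurable_pi_apply i) hW, Measure.pi_map_eval, Measure.smul_apply,
      smul_eq_mul, Finset.prod_const, Finset.card_erase_of_mem (Finset.mem_univ i),
      Finset.card_univ]
  rw [Set.ofPred_exists]
  refine (measure_iUnion_fintype_le _ _).trans_eq ?_
  simp only [hcoord, Finset.sum_const, Finset.card_univ, nsmul_eq_mul]

theorem lintegral_pi_le_of_forall_update [DecidableEq ι] {μ : ∀ i, Measure (E i)}
    [∀ i, IsProbabilityMeasure (μ i)] {f : (∀ i, E i) → ℝ≥0∞} (hf : Measurable f) (i : ι)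
    {B : ℝ≥0∞} (h : ∀ x, ∫⁻ y, f (Function.update x i y) ∂(μ i) ≤ B) :
    ∫⁻ x, f x ∂(Measure.pi μ) ≤ B := by
  refine (lintegral_le_of_lmarginal_le {i} hf (measurable_const (a := B)) ?_).trans_eq (by simp)
  intro x
  rw [lmarginal_singleton, lmarginal_singleton]
  simpa using h x

theorem map_swap_pi_pi {κ : Type*} [Fintype κ] {F : ι → κ → Type*}
    {mF : ∀ i j, MeasurableSpace (F i j)} (μ : ∀ i j, Measure (F i j))
    [∀ i j, IsProbabilityMeasure (μ i j)] :
    (Measure.pi fun i => Measure.pi fun j => μ i j).map (fun x j i => x i j)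
      = Measure.pi fun j => Measure.pi fun i => μ i j := by
  have hswap : Measurable fun (x : ∀ i j, F i j) j i => x i j := by fun_prop
  refine (Measure.pi_eq_generateFrom (C := fun j => Set.univ.pi '' Set.univ.pi fun i =>
    {s : Set (F i j) | MeasurableSet s}) (fun _ => generateFrom_pi) (fun _ => isPiSystem_pi)
    (fun j => ⟨fun _ => Set.univ, fun _ => ⟨fun _ => Set.univ, by simp, by simp⟩,
      fun _ => by simp, by simp [Set.iUnion_const]⟩) ?_).symm
  intro s hs
  choose t ht hts using hs
  obtain rfl : (fun j => Set.univ.pi (t j)) = s := funext hts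
  have ht' : ∀ j i, MeasurableSet (t j i) := fun j i => ht j i (Set.mem_univ i)
  have hpreimage : (fun (x : ∀ i j, F i j) j i => x i j) ⁻¹'
      Set.univ.pi (fun j => Set.univ.pi (t j)) =
        Set.univ.pi fun i => Set.univ.pi fun j => t j i := by
    ext x
    simp only [Set.mem_preimage, Set.mem_pi, Set.mem_univ, forall_true_left]
    exact forall_comm
  rw [Measure.map_apply hswap (.univ_pi fun j => .univ_pi fun i => ht' j i), hpreimage]
  simp only [Measure.pi_pi]
  exact Finset.prod_comm

theorem ae_linearIndependent {V : Type*} [NormedAddCommGroup V] [NormedSpace ℝ V]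
    [FiniteDimensional ℝ V] [MeasurableSpace V] [BorelSpace V] (μ : Measure V)
    [μ.IsAddHaarMeasure] {n : ℕ} (hn : n ≤ Module.finrank ℝ V) (ν : Fin n → Measure V)
    [∀ i, SigmaFinite (ν i)] (hν : ∀ i, ν i ≪ μ) :
    ∀ᵐ v ∂(Measure.pi ν), LinearIndependent ℝ v := by
  induction n with
  | zero => exact Eventually.of_forall fun v => linearIndependent_empty_type
  | succ n ih =>
    have hopen : MeasurableSet {v : Fin (n + 1) → V | LinearIndependent ℝ v} :=
      isOpen_setOfPred_linearIndependent.measurableSet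
    let e := MeasurableEquiv.piFinSuccAbove (fun _ : Fin (n + 1) => V) 0
    have he : ∀ x v, e.symm (x, v) = Fin.cons x v := fun x v => by
      simp [e, MeasurableEquiv.piFinSuccAbove_symm_apply, Fin.insertNthEquiv]
    have hcons : MeasurableSet {x : V × (Fin n → V) | LinearIndependent ℝ (e.symm x)} :=
      e.symm.measurable hopen
    rw [← (measurePreserving_piFinSuccAbove ν 0).symm.map_eq,
      ae_map_iff e.symm.measurable.aemeasurable hopen, ← Measure.prod_swap,
      ae_map_iff measurable_swap.aemeasurable hcons]
    refine (Measure.ae_prod_mem_iff_ae_ae_mem (measurable_swap hcons)).2 ?_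
    filter_upwards [ih (by omega) (fun j => ν (Fin.succAbove 0 j)) fun j => hν _] with v hv
    have hspan : Submodule.span ℝ (Set.range v) ≠ ⊤ := fun htop => by
      have hrank := finrank_range_le_card (R := ℝ) v
      rw [Set.finrank, htop, finrank_top, Fintype.card_fin] at hrank
      omega
    have hnull := hν 0 (Measure.addHaar_submodule μ _ hspan)
    filter_upwards [measure_eq_zero_iff_ae_notMem.1 hnull] with x hx
    change LinearIndependent ℝ (e.symm (x, v))
    rw [he, linearIndependent_finCons]
    exact ⟨hv, hx⟩

end ProductMeasures

section SquaredNorm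

variable {n : Type*} [Fintype n]

/-- The square of the Euclidean norm, for vectors indexed by a finite type (whose own norm is the
sup norm). -/
noncomputable def normSq (v : n → ℝ) : ℝ := v ⬝ᵥ v

theorem normSq_eq_sum (v : n → ℝ) : normSq v = ∑ i, v i ^ 2 := by
  simp [normSq, dotProduct, sq]

theorem normSq_nonneg (v : n → ℝ) : 0 ≤ normSq v := by
  rw [normSq_eq_sum]; positivity

theorem normSq_add (v w : n → ℝ) : normSq (v + w) = normSq v + 2 * (v ⬝ᵥ w) + normSq w := by
  simp only [normSq, add_dotProduct, dotProduct_add, dotProduct_comm w v]; ring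

theorem normSq_sub (v w : n → ℝ) : normSq (v - w) = normSq v - 2 * (v ⬝ᵥ w) + normSq w := by
  simp only [normSq, sub_dotProduct, dotProduct_sub, dotProduct_comm w v]; ring

theorem normSq_neg (v : n → ℝ) : normSq (-v) = normSq v := by
  rw [normSq, normSq, neg_dotProduct_neg]

theorem normSq_add_le (v w : n → ℝ) :
    normSq (v + w) ≤ 2 * normSq v + 2 * normSq w := by
  have := normSq_nonneg (v - w)
  rw [normSq_sub] at this
  rw [normSq_add]
  linarith

theorem normSq_mulVec {k : Type*} [Fintype k] (A : Matrix k n ℝ) (v : n → ℝ) :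
    normSq (A *ᵥ v) = v ⬝ᵥ ((Aᵀ * A) *ᵥ v) := by
  rw [normSq, ← mulVec_mulVec, dotProduct_mulVec v, vecMul_transpose]

@[fun_prop]
theorem continuous_normSq : Continuous (normSq : (n → ℝ) → ℝ) := by
  simp_rw [funext (normSq_eq_sum (n := n))]
  fun_prop

end SquaredNorm

section GramDeterminant

variable {n : Type*} [Fintype n] [DecidableEq n]

theorem det_one_add_smul_eq_prod_eigenvalues {A : Matrix n n ℝ} (hA : A.IsHermitian) (t : ℝ) :
    (1 + t • A).det = ∏ i, (1 + t * hA.eigenvalues i) := by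
  let φ := Unitary.conjStarAlgAut ℝ (Matrix n n ℝ) hA.eigenvectorUnitary
  have hdet : ∀ M, (φ M).det = M.det := fun M => by
    rw [Unitary.conjStarAlgAut_apply, det_mul_comm, ← mul_assoc, Unitary.coe_star_mul_self, one_mul]
  have hφ : 1 + t • A = φ (diagonal fun i => 1 + t * hA.eigenvalues i) := by
    have hdiag : diagonal (fun i => 1 + t * hA.eigenvalues i)
        = 1 + t • diagonal hA.eigenvalues := by
      rw [← diagonal_one, ← diagonal_smul, diagonal_add]
      rfl
    rw [hdiag, map_add, map_one, map_smul]
    congr 2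
    exact hA.spectral_theorem
  rw [hφ, hdet, det_diagonal]

variable {nR nT : ℕ}

/-- The determinant of `1 + ρ² H Hᵀ`. Up to a constant, half its logarithm is the mutual information
of the channel `H`, and the decoding error probability of one pair of codewords is of the order of
its `-l/2`-th power. -/
noncomputable def gramDet (ρ : ℝ) (H : Fin nR → Fin nT → ℝ) : ℝ :=
  (1 + ρ ^ 2 • (of H * (of H)ᵀ)).det

theorem gramDet_eq_det_transpose_mul (ρ : ℝ) (H : Fin nR → Fin nT → ℝ) :
    gramDet ρ H = (1 + ρ ^ 2 • ((of H)ᵀ * of H)).det := by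
  rw [gramDet, ← smul_mul, det_one_add_mul_comm, Matrix.mul_smul]

theorem gramDet_eq_prod (ρ : ℝ) (H : Fin nR → Fin nT → ℝ) :
    gramDet ρ H = ∏ i, (1 + ρ ^ 2 * eig H i) :=
  det_one_add_smul_eq_prod_eigenvalues (isHermitian_mul_conjTranspose_self (of H)) (ρ ^ 2)

theorem eig_nonneg (H : Fin nR → Fin nT → ℝ) (i : Fin nR) : 0 ≤ eig H i :=
  eigenvalues_self_mul_conjTranspose_nonneg _ _

theorem eig_pos {H : Fin nR → Fin nT → ℝ} (hH : LinearIndependent ℝ H) (i : Fin nR) :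
    0 < eig H i := by
  refine PosDef.eigenvalues_pos (A := of H * (of H)ᴴ) ?_ i
  exact PosDef.mul_conjTranspose_self _ (Matrix.vecMul_injective_iff.2 hH)

theorem one_le_gramDet (ρ : ℝ) (H : Fin nR → Fin nT → ℝ) : 1 ≤ gramDet ρ H := by
  rw [gramDet_eq_prod]
  refine Finset.prod_induction _ (1 ≤ ·) (fun _ _ => one_le_mul_of_one_le_of_one_le) le_rfl
    fun i _ => ?_
  exact le_add_of_nonneg_right (mul_nonneg (sq_nonneg ρ) (eig_nonneg H i))

theorem gramDet_pos (ρ : ℝ) (H : Fin nR → Fin nT → ℝ) : 0 < gramDet ρ H :=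
  one_pos.trans_le (one_le_gramDet ρ H)

@[fun_prop]
theorem continuous_gramDet (ρ : ℝ) : Continuous (gramDet ρ : (Fin nR → Fin nT → ℝ) → ℝ) := by
  have h : Continuous fun H : Fin nR → Fin nT → ℝ => of H * (of H)ᵀ :=
    Continuous.matrix_mul continuous_id (Continuous.matrix_transpose continuous_id)
  exact Continuous.matrix_det (continuous_const.add (h.const_smul (ρ ^ 2)))

theorem gramDet_smul (ρ s : ℝ) (H : Fin nR → Fin nT → ℝ) :
    gramDet ρ (s • H) = gramDet (s * ρ) H := by
  have hsmul : of (s • H) = s • of H := rfl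
  rw [gramDet, gramDet, hsmul, transpose_smul, Matrix.smul_mul, Matrix.mul_smul, smul_smul,
    smul_smul]
  congr 3
  ring

/-- If some eigenvalue contributes a factor at least `2` to `gramDet (s * ρ) H`, that factor alone
accounts for the gain `2 * s ^ 2`. -/
theorem gramDet_mul_le (ρ : ℝ) {s : ℝ} (hs : s ^ 2 ≤ 1) (H : Fin nR → Fin nT → ℝ) :
    gramDet (s * ρ) H ≤ max (2 ^ nR) (2 * s ^ 2 * gramDet ρ H) := by
  set t : Fin nR → ℝ := fun i => ρ ^ 2 * eig H i
  have ht : ∀ i, 0 ≤ t i := fun i => mul_nonneg (sq_nonneg ρ) (eig_nonneg H i)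
  have hst : ∀ i, 0 ≤ s ^ 2 * t i := fun i => mul_nonneg (sq_nonneg s) (ht i)
  have hgram : gramDet (s * ρ) H = ∏ i, (1 + s ^ 2 * t i) := by
    simp only [gramDet_eq_prod, mul_pow, mul_assoc, t]
  rw [hgram, gramDet_eq_prod]
  by_cases! hlarge : ∃ i, 1 ≤ s ^ 2 * t i
  · obtain ⟨i, hi⟩ := hlarge
    refine le_max_of_le_right ?_
    rw [← Finset.mul_prod_erase _ (fun k => 1 + s ^ 2 * t k) (Finset.mem_univ i),
      ← Finset.mul_prod_erase _ (fun k => 1 + t k) (Finset.mem_univ i), ← mul_assoc (2 * s ^ 2)]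
    have hfactor : 1 + s ^ 2 * t i ≤ 2 * s ^ 2 * (1 + t i) := by nlinarith [sq_nonneg s]
    refine mul_le_mul hfactor (Finset.prod_le_prod (fun k _ => by linarith [hst k]) fun k _ => ?_)
      (Finset.prod_nonneg fun k _ => by linarith [hst k]) (by linarith [hst i])
    nlinarith [ht k]
  · refine le_max_of_le_left ?_
    calc ∏ i, (1 + s ^ 2 * t i) ≤ ∏ _i : Fin nR, (2 : ℝ) :=
          Finset.prod_le_prod (fun i _ => by linarith [hst i]) fun i _ => by linarith [hlarge i]
      _ = 2 ^ nR := by simp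

end GramDeterminant

section GaussianIntegral

variable {n : Type*} [Fintype n]

theorem lintegral_exp_neg_normSq {κ : ℝ} (hκ : 0 < κ) :
    ∫⁻ x : n → ℝ, ENNReal.ofReal (Real.exp (-normSq x / κ))
      = ENNReal.ofReal (√(Real.pi * κ) ^ Fintype.card n) := by
  have hprod : ∀ x : n → ℝ, ENNReal.ofReal (Real.exp (-normSq x / κ))
      = ∏ i, ENNReal.ofReal (Real.exp (-κ⁻¹ * x i ^ 2)) := by
    intro x
    rw [← ENNReal.ofReal_prod_of_nonneg fun i _ => (Real.exp_pos _).le, ← Real.exp_sum,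
      normSq_eq_sum, ← Finset.mul_sum]
    congr 2
    field_simp
  simp_rw [hprod]
  rw [volume_pi, lintegral_pi_prod (f := fun _ t => ENNReal.ofReal (Real.exp (-κ⁻¹ * t ^ 2)))
    fun _ => by fun_prop]
  rw [← ofReal_integral_eq_lintegral_ofReal (integrable_exp_neg_mul_sq (inv_pos.2 hκ))
    (ae_of_all _ fun x => (Real.exp_pos _).le), integral_gaussian]
  simp [ENNReal.ofReal_pow]

variable [DecidableEq n]

theorem lintegral_exp_neg_normSq_mulVec {κ : ℝ} (hκ : 0 < κ) {B : Matrix n n ℝ} (hB : B.det ≠ 0) :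
    ∫⁻ x : n → ℝ, ENNReal.ofReal (Real.exp (-normSq (B *ᵥ x) / κ))
      = ENNReal.ofReal (√(Real.pi * κ) ^ Fintype.card n / |B.det|) := by
  have hmeas : Measurable (toLin' B) := (LinearMap.continuous_of_finiteDimensional _).measurable
  calc ∫⁻ x : n → ℝ, ENNReal.ofReal (Real.exp (-normSq (B *ᵥ x) / κ))
      = ∫⁻ x, ENNReal.ofReal (Real.exp (-normSq x / κ)) ∂(Measure.map (toLin' B) volume) := by
        rw [lintegral_map (by fun_prop) hmeas]
        simp
    _ = _ := by
        rw [Real.map_matrix_volume_pi_eq_smul_volume_pi hB, lintegral_smul_measure,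
          lintegral_exp_neg_normSq hκ, smul_eq_mul, ← ENNReal.ofReal_mul (abs_nonneg _), abs_inv,
          div_eq_inv_mul]

theorem lintegral_exp_neg_posDef {κ : ℝ} (hκ : 0 < κ) {M : Matrix n n ℝ} (hM : M.PosDef) :
    ∫⁻ x : n → ℝ, ENNReal.ofReal (Real.exp (-(x ⬝ᵥ M *ᵥ x) / κ))
      = ENNReal.ofReal (√(Real.pi * κ) ^ Fintype.card n / √M.det) := by
  obtain ⟨B, rfl⟩ : ∃ B : Matrix n n ℝ, M = Bᵀ * B := by
    open scoped MatrixOrder in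
    obtain ⟨B, hB⟩ := CStarAlgebra.nonneg_iff_eq_star_mul_self.mp hM.posSemidef.nonneg
    exact ⟨B, by rw [hB, star_eq_conjTranspose, conjTranspose_eq_transpose_of_trivial]⟩
  have hdet : (Bᵀ * B).det = B.det ^ 2 := by rw [det_mul, det_transpose, sq]
  have hB : B.det ≠ 0 := fun h0 => hM.det_pos.ne' (by rw [hdet, h0, zero_pow two_ne_zero])
  simp_rw [← normSq_mulVec]
  rw [lintegral_exp_neg_normSq_mulVec hκ hB, hdet, Real.sqrt_sq_eq_abs]

variable {nR nT : ℕ}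

/-- Tikhonov-regularized least squares: `x₀` is the minimizer, and the regularized residual exceeds
its minimum by a quadratic form. -/
theorem exists_normSq_sub_mulVec_add_eq {ρ : ℝ} (hρ : 0 < ρ) (H : Fin nR → Fin nT → ℝ)
    (y : Fin nR → ℝ) : ∃ x₀, ∀ u,
      normSq (y - of H *ᵥ (u + x₀)) + normSq (u + x₀) / ρ ^ 2
        = (normSq (of H *ᵥ u) + normSq u / ρ ^ 2)
          + (normSq (y - of H *ᵥ x₀) + normSq x₀ / ρ ^ 2) := by
  set M := 1 + ρ ^ 2 • ((of H)ᵀ * of H) with hM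
  have hdet : IsUnit M.det := by
    rw [hM, ← gramDet_eq_det_transpose_mul]
    exact (gramDet_pos ρ H).ne'.isUnit
  set b := ρ ^ 2 • ((of H)ᵀ *ᵥ y) with hb
  have hsolve : M *ᵥ (M⁻¹ *ᵥ b) = b := by rw [mulVec_mulVec, mul_nonsing_inv _ hdet, one_mulVec]
  set x₀ := M⁻¹ *ᵥ b
  refine ⟨x₀, fun u => ?_⟩
  have hadjoint : ∀ w : Fin nR → ℝ, ((of H)ᵀ *ᵥ w) ⬝ᵥ u = w ⬝ᵥ (of H *ᵥ u) := fun w => by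
    rw [mulVec_transpose, dotProduct_mulVec]
  have horthogonal : (y - of H *ᵥ x₀) ⬝ᵥ (of H *ᵥ u) = (x₀ ⬝ᵥ u) / ρ ^ 2 := by
    have hnormal := congrArg (· ⬝ᵥ u) hsolve
    simp only [hM, hb, add_mulVec, one_mulVec, smul_mulVec, ← mulVec_mulVec, add_dotProduct,
      smul_dotProduct, hadjoint, smul_eq_mul] at hnormal
    rw [sub_dotProduct, eq_div_iff (by positivity)]
    linarith
  have hresidual : y - of H *ᵥ (u + x₀) = (y - of H *ᵥ x₀) - of H *ᵥ u := by
    rw [mulVec_add]; abel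
  rw [hresidual, normSq_sub, horthogonal, normSq_add, dotProduct_comm u x₀]
  ring

theorem lintegral_exp_neg_normSq_mulVec_add {ρ κ : ℝ} (hρ : 0 < ρ) (hκ : 0 < κ)
    (H : Fin nR → Fin nT → ℝ) :
    ∫⁻ u, ENNReal.ofReal (Real.exp (-(normSq (of H *ᵥ u) + normSq u / ρ ^ 2) / κ))
      = ENNReal.ofReal ((√(Real.pi * κ) * ρ) ^ nT / √(gramDet ρ H)) := by
  set M := 1 + ρ ^ 2 • ((of H)ᵀ * of H) with hM
  have hMpos : M.PosDef := by
    have hgram := posSemidef_conjTranspose_mul_self (of H)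
    rw [conjTranspose_eq_transpose_of_trivial] at hgram
    exact PosDef.one.add_posSemidef (hgram.smul (sq_nonneg ρ))
  have hform : ∀ u, normSq (of H *ᵥ u) + normSq u / ρ ^ 2 = (u ⬝ᵥ M *ᵥ u) / ρ ^ 2 := fun u => by
    rw [hM, add_mulVec, one_mulVec, smul_mulVec, dotProduct_add, dotProduct_smul, ← normSq_mulVec,
      smul_eq_mul, ← normSq.eq_1 u]
    field_simp
    ring
  calc ∫⁻ u, ENNReal.ofReal (Real.exp (-(normSq (of H *ᵥ u) + normSq u / ρ ^ 2) / κ))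
      = ∫⁻ u, ENNReal.ofReal (Real.exp (-(u ⬝ᵥ M *ᵥ u) / (κ * ρ ^ 2))) := by
        simp_rw [hform, mul_comm κ, ← div_div, neg_div]
    _ = ENNReal.ofReal ((√(Real.pi * κ) * ρ) ^ nT / √(gramDet ρ H)) := by
        rw [lintegral_exp_neg_posDef (by positivity) hMpos, hM, ← gramDet_eq_det_transpose_mul,
          ← mul_assoc, Real.sqrt_mul (by positivity), Real.sqrt_sq hρ.le, Fintype.card_fin]

theorem lintegral_exp_neg_normSq_sub_mulVec_add_le {ρ κ : ℝ} (hρ : 0 < ρ) (hκ : 0 < κ)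
    (H : Fin nR → Fin nT → ℝ) (y : Fin nR → ℝ) :
    ∫⁻ x, ENNReal.ofReal (Real.exp (-(normSq (y - of H *ᵥ x) + normSq x / ρ ^ 2) / κ))
      ≤ ENNReal.ofReal ((√(Real.pi * κ) * ρ) ^ nT / √(gramDet ρ H)) := by
  obtain ⟨x₀, hx₀⟩ := exists_normSq_sub_mulVec_add_eq hρ H y
  rw [← lintegral_exp_neg_normSq_mulVec_add hρ hκ H, ← lintegral_add_right_eq_self _ x₀]
  refine lintegral_mono fun u => ENNReal.ofReal_le_ofReal (Real.exp_le_exp.2 ?_)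
  rw [hx₀, div_le_div_iff_of_pos_right hκ, neg_le_neg_iff]
  exact le_add_of_nonneg_right (add_nonneg (normSq_nonneg _)
    (div_nonneg (normSq_nonneg x₀) (sq_nonneg ρ)))

end GaussianIntegral

section Divergence

open InformationTheory

variable {α β : Type*} [MeasurableSpace α] [MeasurableSpace β]

/-- The lower bound of Donsker and Varadhan. -/
theorem ofReal_integral_sub_log_le_klDiv {P Q : Measure α} [IsProbabilityMeasure P]
    [IsProbabilityMeasure Q] {g : α → ℝ} (hg : Integrable g P)
    (hQ : Integrable (fun x => Real.exp (g x)) Q) :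
    ENNReal.ofReal (∫ x, g x ∂P - Real.log (∫ x, Real.exp (g x) ∂Q)) ≤ klDiv P Q := by
  by_cases htop : klDiv P Q = ∞
  · rw [htop]; exact le_top
  obtain ⟨hac, hint⟩ := klDiv_ne_top_iff.1 htop
  rw [klDiv_of_ac_of_integrable hac hint]
  refine ENNReal.ofReal_le_ofReal ?_
  have := isProbabilityMeasure_tilted hQ
  have htilted := integral_llr_tilted_right hac hg hQ hint
  have hnonneg := integral_llr_add_sub_measure_univ_nonneg
    (hac.trans (absolutelyContinuous_tilted hQ)) (integrable_llr_tilted_right hac hg hint hQ)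
  simp only [probReal_univ] at hnonneg ⊢
  linarith

theorem rnDeriv_le_of_le_smul {P Q : Measure α} [SigmaFinite P] [SigmaFinite Q] {c : ℝ≥0∞}
    (h : P ≤ c • Q) : ∀ᵐ x ∂Q, P.rnDeriv Q x ≤ c := by
  refine ae_le_of_forall_setLIntegral_le_of_sigmaFinite (P.measurable_rnDeriv Q) fun s _ _ => ?_
  rw [Measure.setLIntegral_rnDeriv (Measure.absolutelyContinuous_of_le_smul h), setLIntegral_const]
  exact h s

theorem klFun_add_self_le {t B : ℝ} (ht : 0 ≤ t) (htB : t ≤ B) :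
    klFun t + t ≤ Real.log B * t + 1 := by
  rw [klFun_apply]
  rcases ht.eq_or_lt with rfl | ht
  · simp
  · nlinarith [Real.log_le_log ht htB]

theorem klDiv_le_of_le_smul {P Q : Measure α} [IsProbabilityMeasure P] [IsProbabilityMeasure Q]
    {B : ℝ} (h : P ≤ ENNReal.ofReal B • Q) : klDiv P Q ≤ ENNReal.ofReal (Real.log B) := by
  have hlog : 0 ≤ Real.log B := Real.log_nonneg (by simpa using h Set.univ)
  have hac : P ≪ Q := Measure.absolutelyContinuous_of_le_smul h
  have hmeas : Measurable (P.rnDeriv Q) := P.measurable_rnDeriv Q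
  have hone : ∫⁻ x, P.rnDeriv Q x ∂Q = 1 := by rw [Measure.lintegral_rnDeriv hac, measure_univ]
  have hpointwise : ∀ᵐ x ∂Q, ENNReal.ofReal (klFun (P.rnDeriv Q x).toReal) + P.rnDeriv Q x
      ≤ ENNReal.ofReal (Real.log B) * P.rnDeriv Q x + 1 := by
    filter_upwards [rnDeriv_le_of_le_smul h] with x hx
    lift P.rnDeriv Q x to ℝ≥0 using (hx.trans_lt ENNReal.ofReal_lt_top).ne with t
    have htB : (t : ℝ) ≤ B := NNReal.coe_le_coe.2 (ENNReal.coe_le_coe.1 hx) |>.trans_eq <|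
      Real.coe_toNNReal B <| by
        by_contra! hB
        simpa [ENNReal.ofReal_of_nonpos hB.le] using h Set.univ
    rw [ENNReal.coe_toReal, ← ENNReal.ofReal_coe_nnreal, ← ENNReal.ofReal_mul hlog,
      ← ENNReal.ofReal_one, ← ENNReal.ofReal_add (klFun_nonneg t.coe_nonneg) t.coe_nonneg,
      ← ENNReal.ofReal_add (mul_nonneg hlog t.coe_nonneg) zero_le_one]
    exact ENNReal.ofReal_le_ofReal (klFun_add_self_le t.coe_nonneg htB)
  rw [klDiv_eq_lintegral_klFun_of_ac hac, ← ENNReal.add_le_add_iff_right ENNReal.one_ne_top]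
  calc ∫⁻ x, ENNReal.ofReal (klFun (P.rnDeriv Q x).toReal) ∂Q + 1
      = ∫⁻ x, (ENNReal.ofReal (klFun (P.rnDeriv Q x).toReal) + P.rnDeriv Q x) ∂Q := by
        rw [lintegral_add_right _ hmeas, hone]
    _ ≤ ∫⁻ x, (ENNReal.ofReal (Real.log B) * P.rnDeriv Q x + 1) ∂Q := lintegral_mono_ae hpointwise
    _ = ENNReal.ofReal (Real.log B) + 1 := by
        rw [lintegral_add_right _ measurable_const, lintegral_const_mul _ hmeas, hone]
        simp

theorem klDiv_prod_marginals_le [StandardBorelSpace α] [Nonempty α] (P : Measure (α × β))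
    [IsProbabilityMeasure P] (N : Measure β) [IsProbabilityMeasure N] :
    klDiv P (P.fst.prod P.snd) ≤ klDiv P (P.fst.prod N) := by
  set S := P.map Prod.swap with hS
  have : IsProbabilityMeasure S := Measure.isProbabilityMeasure_map measurable_swap.aemeasurable
  have hSP : S.map Prod.swap = P := by
    rw [hS, Measure.map_map measurable_swap measurable_swap, Prod.swap_swap_eq, Measure.map_id]
  have hfst : S.fst = P.snd := Measure.fst_map_swap
  have hchain : klDiv S (N ⊗ₘ Kernel.const β P.fst)
      = klDiv S.fst N + klDiv S (S.fst ⊗ₘ Kernel.const β P.fst) := by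
    simpa only [S.disintegrate S.condKernel]
      using klDiv_compProd_eq_add S.fst N S.condKernel (Kernel.const β P.fst)
  calc klDiv P (P.fst.prod P.snd)
      = klDiv (S.map Prod.swap) ((P.snd.prod P.fst).map Prod.swap) := by
        rw [hSP, Measure.prod_swap]
    _ ≤ klDiv S (P.snd.prod P.fst) := klDiv_map_le _ _ measurable_swap
    _ = klDiv S (S.fst ⊗ₘ Kernel.const β P.fst) := by rw [Measure.compProd_const, hfst]
    _ ≤ klDiv S (N ⊗ₘ Kernel.const β P.fst) := hchain ▸ le_add_self
    _ = klDiv (P.map Prod.swap) ((P.fst.prod N).map Prod.swap) := by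
        rw [Measure.compProd_const, Measure.prod_swap]
    _ ≤ klDiv P (P.fst.prod N) := klDiv_map_le _ _ measurable_swap

end Divergence

section TruncatedExponential

theorem truncExp_factor_pos (m : ℝ) : 0 < if m = 0 then 1 else m / (1 - Real.exp (-m)) := by
  split_ifs with hm
  · exact one_pos
  · rcases lt_or_gt_of_ne hm with hm | hm
    · exact div_pos_of_neg_of_neg hm (sub_neg.2 (Real.one_lt_exp_iff.2 (neg_pos.2 hm)))
    · exact div_pos hm (sub_pos.2 (Real.exp_lt_one_iff.2 (neg_lt_zero.2 hm)))

theorem integral_exp_neg_mul_div {A m : ℝ} (hA : A ≠ 0) (hm : m ≠ 0) :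
    ∫ x in (0 : ℝ)..A, Real.exp (-(m * x / A)) = A / m * (1 - Real.exp (-m)) := by
  have hlinear : ∀ x, -(m * x / A) = -(m / A) * x := fun x => by ring
  have hend : -(m / A) * A = -m := by field_simp
  simp_rw [hlinear]
  rw [intervalIntegral.integral_comp_mul_left Real.exp (neg_ne_zero.2 (div_ne_zero hm hA)),
    integral_exp, mul_zero, Real.exp_zero, smul_eq_mul, hend]
  field_simp
  ring

theorem isProbabilityMeasure_truncExp {A : ℝ} (hA : 0 < A) (m : ℝ) :
    IsProbabilityMeasure (truncExp A m) := by
  have hcont : Continuous (truncExpPDF A m) := by unfold truncExpPDF; fun_prop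
  have hnonneg : ∀ x, 0 ≤ truncExpPDF A m x := fun x => by
    have := truncExp_factor_pos m
    unfold truncExpPDF
    positivity
  refine ⟨?_⟩
  rw [truncExp, withDensity_apply _ .univ, Measure.restrict_univ,
    ← ofReal_integral_eq_lintegral_ofReal hcont.integrableOn_Icc (ae_of_all _ hnonneg),
    integral_Icc_eq_integral_Ioc, ← intervalIntegral.integral_of_le hA.le]
  simp_rw [truncExpPDF]
  rw [intervalIntegral.integral_const_mul]
  split_ifs with hm
  · simp [hm, hA.ne']
  · have hexp : 1 - Real.exp (-m) ≠ 0 := by simpa [sub_eq_zero, eq_comm (a := (1 : ℝ))] using hm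
    rw [integral_exp_neg_mul_div hA.ne' hm]
    field_simp
    simp

theorem truncExpPDF_le {A : ℝ} (m : ℝ) {x : ℝ} (hx : x ∈ Set.Icc 0 A) :
    truncExpPDF A m x
      ≤ 1 / A * (if m = 0 then 1 else m / (1 - Real.exp (-m))) * Real.exp |m| := by
  have hA : 0 ≤ A := hx.1.trans hx.2
  have hfactor := truncExp_factor_pos m
  refine mul_le_mul_of_nonneg_left (Real.exp_le_exp.2 ?_) (by positivity)
  calc -(m * x / A) = -m * (x / A) := by ring
    _ ≤ |m| * (x / A) := mul_le_mul_of_nonneg_right (neg_le_abs m) (div_nonneg hx.1 hA)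
    _ ≤ |m| := mul_le_of_le_one_right (abs_nonneg m) (div_le_one_of_le₀ hx.2 hA)

theorem exists_truncExp_le {a κ : ℝ} (ha : 0 < a) (hκ : 0 < κ) (m : ℝ) :
    ∃ C : ℝ, 0 < C ∧ ∀ ρ : ℝ, 0 < ρ → truncExp (ρ * a) m ≤ (C / ρ).toNNReal •
      volume.withDensity fun x => ENNReal.ofReal (Real.exp (-(x ^ 2 / ρ ^ 2) / κ)) := by
  set k : ℝ := if m = 0 then 1 else m / (1 - Real.exp (-m))
  have hk : 0 < k := truncExp_factor_pos m
  refine ⟨1 / a * k * Real.exp |m| * Real.exp (a ^ 2 / κ), by positivity, fun ρ hρ => ?_⟩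
  change _ ≤ ENNReal.ofReal _ • (_ : Measure ℝ)
  rw [truncExp, ← withDensity_indicator measurableSet_Icc, ← withDensity_smul _ (by fun_prop)]
  refine withDensity_mono (ae_of_all _ fun x => Set.indicator_le (fun x hx => ?_) x)
  have hgauss : 1 ≤ Real.exp (a ^ 2 / κ) * Real.exp (-(x ^ 2 / ρ ^ 2) / κ) := by
    rw [← Real.exp_add, Real.one_le_exp_iff, ← add_div]
    refine div_nonneg ?_ hκ.le
    rw [← sub_eq_add_neg, sub_nonneg, div_le_iff₀ (by positivity), ← mul_pow, mul_comm a]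
    exact pow_le_pow_left₀ hx.1 hx.2 2
  rw [Pi.smul_apply, smul_eq_mul, ← ENNReal.ofReal_mul (by positivity)]
  refine ENNReal.ofReal_le_ofReal ?_
  calc truncExpPDF (ρ * a) m x ≤ 1 / (ρ * a) * k * Real.exp |m| := truncExpPDF_le m hx
    _ ≤ 1 / (ρ * a) * k * Real.exp |m|
        * (Real.exp (a ^ 2 / κ) * Real.exp (-(x ^ 2 / ρ ^ 2) / κ)) :=
        le_mul_of_one_le_right (by positivity) hgauss
    _ = _ := by field_simp

variable {nR nT : ℕ}

theorem Channel.σ_real_pos (c : Channel nR nT) : 0 < (c.σ : ℝ) := NNReal.coe_pos.2 c.σ_pos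

theorem Channel.peak_pos (c : Channel nR nT) {ρ : ℝ} (hρ : 0 < ρ) : 0 < c.peak ρ :=
  div_pos (mul_pos hρ c.σ_real_pos) c.α_pos

theorem isProbabilityMeasure_teInput (c : Channel nR nT) (m : ℝ) {ρ : ℝ} (hρ : 0 < ρ) :
    IsProbabilityMeasure (c.teInput m ρ) := by
  have := isProbabilityMeasure_truncExp (c.peak_pos hρ) m
  unfold Channel.teInput
  infer_instance

theorem exists_teInput_le (c : Channel nR nT) (m : ℝ) {κ : ℝ} (hκ : 0 < κ) :
    ∃ C : ℝ, 0 < C ∧ ∀ ρ : ℝ, 0 < ρ → c.teInput m ρ ≤ (C / ρ ^ nT).toNNReal •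
      volume.withDensity fun x => ENNReal.ofReal (Real.exp (-(normSq x / ρ ^ 2) / κ)) := by
  obtain ⟨C, hC, hle⟩ := exists_truncExp_le (div_pos c.σ_real_pos c.α_pos) hκ m
  refine ⟨C ^ nT, by positivity, fun ρ hρ => ?_⟩
  have := isProbabilityMeasure_truncExp (c.peak_pos hρ) m
  have hpeak : c.peak ρ = ρ * (c.σ / c.α) := mul_div_assoc _ _ _
  have hpi := pi_le_smul_pi (ι := Fin nT) (μ := fun _ => truncExp (c.peak ρ) m)
    (fun _ => (Real.toNNReal_pos.2 (div_pos hC hρ)).ne') fun _ => hpeak ▸ hle ρ hρ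
  rw [pi_withDensity fun _ => by fun_prop, ← volume_pi, Finset.prod_const, Finset.card_univ,
    Fintype.card_fin, ← Real.toNNReal_pow (by positivity), div_pow] at hpi
  refine hpi.trans_eq ?_
  congr! 3
  rw [← ENNReal.ofReal_prod_of_nonneg fun i _ => (Real.exp_pos _).le, ← Real.exp_sum,
    ← Finset.sum_div, Finset.sum_neg_distrib, ← Finset.sum_div, ← normSq_eq_sum]

theorem exists_lintegral_teInput_exp_le (c : Channel nR nT) (m : ℝ) {κ : ℝ} (hκ : 0 < κ) :
    ∃ C : ℝ, 0 < C ∧ ∀ ρ : ℝ, 0 < ρ → ∀ (H : Fin nR → Fin nT → ℝ) (y : Fin nR → ℝ),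
      ∫⁻ x, ENNReal.ofReal (Real.exp (-normSq (y - of H *ᵥ x) / κ)) ∂(c.teInput m ρ)
        ≤ ENNReal.ofReal (C / √(gramDet ρ H)) := by
  obtain ⟨C, hC, hle⟩ := exists_teInput_le c m hκ
  refine ⟨C * √(Real.pi * κ) ^ nT, by positivity, fun ρ hρ H y => ?_⟩
  set f : (Fin nT → ℝ) → ℝ≥0∞ := fun x =>
    ENNReal.ofReal (Real.exp (-normSq (y - of H *ᵥ x) / κ))
  set w : (Fin nT → ℝ) → ℝ≥0∞ := fun x => ENNReal.ofReal (Real.exp (-(normSq x / ρ ^ 2) / κ))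
  have hmul : ∀ x, (w * f) x = ENNReal.ofReal
      (Real.exp (-(normSq (y - of H *ᵥ x) + normSq x / ρ ^ 2) / κ)) := fun x => by
    rw [Pi.mul_apply, ← ENNReal.ofReal_mul (Real.exp_pos _).le, ← Real.exp_add]
    congr 2
    ring
  calc ∫⁻ x, f x ∂(c.teInput m ρ)
      ≤ ∫⁻ x, f x ∂((C / ρ ^ nT).toNNReal • volume.withDensity w) :=
        lintegral_mono' (hle ρ hρ) le_rfl
    _ = ENNReal.ofReal (C / ρ ^ nT) * ∫⁻ x, (w * f) x := by
        rw [lintegral_smul_measure,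
          lintegral_withDensity_eq_lintegral_mul _ (by fun_prop) (by fun_prop), ENNReal.smul_def,
          smul_eq_mul, ENNReal.ofReal]
    _ ≤ ENNReal.ofReal (C / ρ ^ nT)
          * ENNReal.ofReal ((√(Real.pi * κ) * ρ) ^ nT / √(gramDet ρ H)) := by
        simp_rw [hmul]
        gcongr
        exact lintegral_exp_neg_normSq_sub_mulVec_add_le hρ hκ H y
    _ = ENNReal.ofReal (C * √(Real.pi * κ) ^ nT / √(gramDet ρ H)) := by
        rw [← ENNReal.ofReal_mul (by positivity)]
        congr 1
        rw [mul_pow]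
        field_simp

end TruncatedExponential

section GaussianNoise

variable {n : Type*} [Fintype n]

/-- Density of a centred Gaussian vector whose entries are independent with variance `v`. -/
noncomputable def gaussianDensity (v : ℝ) (z : n → ℝ) : ℝ :=
  (√(2 * Real.pi * v))⁻¹ ^ Fintype.card n * Real.exp (-normSq z / (2 * v))

theorem gaussianDensity_nonneg (v : ℝ) (z : n → ℝ) : 0 ≤ gaussianDensity v z := by
  unfold gaussianDensity; positivity

@[fun_prop]
theorem continuous_gaussianDensity (v : ℝ) : Continuous (gaussianDensity v : (n → ℝ) → ℝ) := by
  unfold gaussianDensity; fun_prop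

theorem pi_gaussianReal_eq_withDensity {v : ℝ≥0} (hv : v ≠ 0) :
    Measure.pi (fun _ : n => gaussianReal 0 v)
      = volume.withDensity fun z => ENNReal.ofReal (gaussianDensity v z) := by
  have hone : gaussianReal 0 v = volume.withDensity (gaussianPDF 0 v) :=
    gaussianReal_of_var_ne_zero 0 hv
  have : SigmaFinite ((volume : Measure ℝ).withDensity (gaussianPDF 0 v)) := by
    rw [← hone]; infer_instance
  rw [hone, pi_withDensity fun _ => measurable_gaussianPDF 0 v, ← volume_pi]
  congr 1
  ext z
  simp only [gaussianPDF, gaussianPDFReal, gaussianDensity]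
  rw [← ENNReal.ofReal_prod_of_nonneg fun i _ => by positivity, Finset.prod_mul_distrib,
    ← Real.exp_sum, Finset.prod_const, Finset.card_univ, normSq_eq_sum, ← Finset.sum_div,
    Finset.sum_neg_distrib]
  simp

variable {nR nT : ℕ}

instance (c : Channel nR nT) : IsProbabilityMeasure c.noiseVec := by
  unfold Channel.noiseVec; infer_instance

theorem noiseVec_eq_withDensity (c : Channel nR nT) :
    c.noiseVec = volume.withDensity fun z => ENNReal.ofReal (gaussianDensity (c.σ ^ 2) z) := by
  rw [Channel.noiseVec, pi_gaussianReal_eq_withDensity (pow_ne_zero 2 c.σ_pos.ne')]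
  simp only [NNReal.coe_pow]

theorem map_const_add_noiseVec (c : Channel nR nT) (w : Fin nR → ℝ) :
    c.noiseVec.map (w + ·)
      = volume.withDensity fun y => ENNReal.ofReal (gaussianDensity (c.σ ^ 2) (y - w)) := by
  ext T hT
  have hpre : MeasurableSet ((w + ·) ⁻¹' T) := (measurable_const_add w) hT
  rw [Measure.map_apply (measurable_const_add w) hT, noiseVec_eq_withDensity,
    withDensity_apply _ hpre, withDensity_apply _ hT, ← lintegral_indicator hpre,
    ← lintegral_indicator hT, ← lintegral_sub_right_eq_self _ w]
  congr 1
  ext y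
  by_cases hy : y ∈ T <;> simp [Set.indicator, hy]

theorem integrable_normSq_noiseVec (c : Channel nR nT) : Integrable normSq c.noiseVec := by
  rw [funext (normSq_eq_sum (n := Fin nR))]
  refine integrable_finsetSum _ fun i _ => ?_
  have hsq : Integrable (fun x : ℝ => x ^ 2) (gaussianReal 0 (c.σ ^ 2)) :=
    (memLp_id_gaussianReal 2).integrable_sq
  exact (measurePreserving_eval (fun _ : Fin nR => gaussianReal 0 (c.σ ^ 2))
    i).integrable_comp_of_integrable hsq

end GaussianNoise

section JointLaw

variable {nR nT : ℕ}

@[fun_prop]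
theorem measurable_addNoise (H : Fin nR → Fin nT → ℝ) :
    Measurable fun xz : (Fin nT → ℝ) × (Fin nR → ℝ) => of H *ᵥ xz.1 + xz.2 :=
  Continuous.measurable (by fun_prop)

@[fun_prop]
theorem measurable_inputOutput (H : Fin nR → Fin nT → ℝ) :
    Measurable fun xz : (Fin nT → ℝ) × (Fin nR → ℝ) => (xz.1, of H *ᵥ xz.1 + xz.2) :=
  measurable_fst.prodMk (measurable_addNoise H)

theorem isProbabilityMeasure_jointXY (c : Channel nR nT) (p : Measure (Fin nT → ℝ))
    [IsProbabilityMeasure p] (H : Fin nR → Fin nT → ℝ) : IsProbabilityMeasure (c.jointXY p H) :=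
  Measure.isProbabilityMeasure_map (measurable_inputOutput H).aemeasurable

theorem fst_jointXY (c : Channel nR nT) (p : Measure (Fin nT → ℝ)) [SFinite p]
    (H : Fin nR → Fin nT → ℝ) : (c.jointXY p H).fst = p := by
  rw [Channel.jointXY, Measure.fst, Measure.map_map measurable_fst (measurable_inputOutput H)]
  exact Measure.fst_prod (μ := p) (ν := c.noiseVec)

theorem measurePreserving_residual (c : Channel nR nT) (p : Measure (Fin nT → ℝ))
    [IsProbabilityMeasure p] (H : Fin nR → Fin nT → ℝ) :
    MeasurePreserving (fun xy => xy.2 - of H *ᵥ xy.1) (c.jointXY p H) c.noiseVec := by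
  have hmeas : Measurable fun xy : (Fin nT → ℝ) × (Fin nR → ℝ) => xy.2 - of H *ᵥ xy.1 :=
    Continuous.measurable (by fun_prop)
  refine ⟨hmeas, ?_⟩
  rw [Channel.jointXY, Measure.map_map hmeas (measurable_inputOutput H)]
  have hcomp : (fun xy => xy.2 - of H *ᵥ xy.1) ∘
      (fun xz : (Fin nT → ℝ) × (Fin nR → ℝ) => (xz.1, of H *ᵥ xz.1 + xz.2)) = Prod.snd :=
    funext fun xz => add_sub_cancel_left _ _
  rw [hcomp]
  exact Measure.snd_prod (μ := p) (ν := c.noiseVec)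

theorem jointXY_le_smul_prod (c : Channel nR nT) {p : Measure (Fin nT → ℝ)} [SFinite p]
    {H : Fin nR → Fin nT → ℝ} {N : Measure (Fin nR → ℝ)} [SFinite N] {B : ℝ≥0∞}
    (h : ∀ᵐ x ∂p, c.noiseVec.map (of H *ᵥ x + ·) ≤ B • N) : c.jointXY p H ≤ B • p.prod N := by
  refine Measure.le_iff.2 fun S hS => ?_
  rw [Channel.jointXY, Measure.map_apply (measurable_inputOutput H) hS,
    Measure.prod_apply (measurable_inputOutput H hS), Measure.smul_apply, Measure.prod_apply hS,
    smul_eq_mul, ← lintegral_const_mul _ (measurable_measure_prodMk_left hS)]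
  refine lintegral_mono_ae ?_
  filter_upwards [h] with x hx
  have hS_x := hx (Prod.mk x ⁻¹' S)
  rwa [Measure.map_apply (measurable_const_add _) (measurable_prodMk_left hS)] at hS_x

theorem map_addNoise_eq_withDensity (c : Channel nR nT) (γ : Measure (Fin nT → ℝ)) [SFinite γ]
    (H : Fin nR → Fin nT → ℝ) :
    (γ.prod c.noiseVec).map (fun xz => of H *ᵥ xz.1 + xz.2) = volume.withDensity fun y =>
      ∫⁻ x, ENNReal.ofReal (gaussianDensity (c.σ ^ 2) (y - of H *ᵥ x)) ∂γ := by
  have hmeas : Measurable fun q : (Fin nT → ℝ) × (Fin nR → ℝ) =>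
      ENNReal.ofReal (gaussianDensity (c.σ ^ 2) (q.2 - of H *ᵥ q.1)) :=
    (Continuous.measurable (by fun_prop)).ennreal_ofReal
  ext T hT
  rw [Measure.map_apply (measurable_addNoise H) hT, Measure.prod_apply (measurable_addNoise H hT),
    withDensity_apply _ hT, ← lintegral_lintegral_swap hmeas.aemeasurable]
  refine lintegral_congr fun x => ?_
  rw [← withDensity_apply _ hT, ← map_const_add_noiseVec,
    Measure.map_apply (measurable_const_add _) hT]
  rfl

end JointLaw

section MutualInformation

variable {nR nT : ℕ}

theorem exists_le_mutualInfo_teInput (c : Channel nR nT) (m : ℝ) :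
    ∃ K : ℝ, ∀ ρ : ℝ, 0 < ρ → ∀ H : Fin nR → Fin nT → ℝ,
      ENNReal.ofReal (Real.log (gramDet ρ H) / 2 - K) ≤ c.mutualInfo (c.teInput m ρ) H := by
  set κ : ℝ := 2 * (c.σ : ℝ) ^ 2
  have hκ : 0 < κ := mul_pos two_pos (pow_pos c.σ_real_pos 2)
  obtain ⟨C, hC, hbound⟩ := exists_lintegral_teInput_exp_le c m hκ
  refine ⟨∫ z, normSq z / κ ∂c.noiseVec + Real.log C, fun ρ hρ H => ?_⟩
  have := isProbabilityMeasure_teInput c m hρ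
  have := isProbabilityMeasure_jointXY c (c.teInput m ρ) H
  set P := c.jointXY (c.teInput m ρ) H with hP
  set g : (Fin nT → ℝ) × (Fin nR → ℝ) → ℝ := fun xy => -normSq (xy.2 - of H *ᵥ xy.1) / κ
  have hresidual := measurePreserving_residual c (c.teInput m ρ) H
  have hnoise : Integrable (fun z => -normSq z / κ) c.noiseVec :=
    (integrable_normSq_noiseVec c).neg.div_const κ
  have hg : Integrable g P := hresidual.integrable_comp_of_integrable hnoise
  have hg_integral : ∫ x, g x ∂P = -∫ z, normSq z / κ ∂c.noiseVec := by
    rw [← integral_neg, ← hresidual.map_eq, integral_map hresidual.measurable.aemeasurable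
      (by fun_prop)]
    simp only [g, hP, neg_div]
  have hexp : Integrable (fun x => Real.exp (g x)) (P.fst.prod P.snd) := by
    refine Integrable.of_bound (by fun_prop) 1 (ae_of_all _ fun x => ?_)
    rw [Real.norm_of_nonneg (Real.exp_pos _).le, Real.exp_le_one_iff]
    exact div_nonpos_of_nonpos_of_nonneg (neg_nonpos.2 (normSq_nonneg _)) hκ.le
  have hexp_integral : ∫ x, Real.exp (g x) ∂(P.fst.prod P.snd) ≤ C / √(gramDet ρ H) := by
    rw [integral_eq_lintegral_of_nonneg_ae (ae_of_all _ fun x => (Real.exp_pos _).le) (by fun_prop)]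
    refine ENNReal.toReal_le_of_le_ofReal (by positivity) ?_
    rw [lintegral_prod_symm _ (by fun_prop), hP, fst_jointXY]
    exact (lintegral_mono (hbound ρ hρ H)).trans_eq (by simp)
  refine le_trans (ENNReal.ofReal_le_ofReal ?_) (ofReal_integral_sub_log_le_klDiv hg hexp)
  have hlog := Real.log_le_log (integral_exp_pos hexp) hexp_integral
  rw [Real.log_div hC.ne' (Real.sqrt_pos.2 (gramDet_pos ρ H)).ne',
    Real.log_sqrt (gramDet_pos ρ H).le] at hlog
  rw [hg_integral]
  linarith

theorem lintegral_le_lintegral_exp_mul {E : Type*} [MeasurableSpace E] [AddGroup E]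
    [MeasurableNeg E] {μ : Measure E} [μ.IsNegInvariant] {F t : E → ℝ} (hF : Measurable F)
    (hF_nonneg : ∀ u, 0 ≤ F u) (hF_even : ∀ u, F (-u) = F u) (ht : Measurable t)
    (ht_odd : ∀ u, t (-u) = -t u) :
    ∫⁻ u, ENNReal.ofReal (F u) ∂μ ≤ ∫⁻ u, ENNReal.ofReal (Real.exp (t u) * F u) ∂μ := by
  have hneg : ∫⁻ u, ENNReal.ofReal (Real.exp (t u) * F u) ∂μ
      = ∫⁻ u, ENNReal.ofReal (Real.exp (-t u) * F u) ∂μ := by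
    rw [← lintegral_neg_eq_self]
    simp_rw [hF_even, ht_odd]
  rw [← ENNReal.mul_le_mul_iff_right two_ne_zero ENNReal.ofNat_ne_top,
    two_mul (∫⁻ u, ENNReal.ofReal (Real.exp (t u) * F u) ∂μ)]
  nth_rw 2 [hneg]
  rw [← lintegral_add_left (by fun_prop), ← lintegral_const_mul _ (by fun_prop)]
  refine lintegral_mono fun u => ?_
  rw [← ENNReal.ofReal_add (mul_nonneg (Real.exp_pos _).le (hF_nonneg u))
    (mul_nonneg (Real.exp_pos _).le (hF_nonneg u)), ← ENNReal.ofReal_ofNat,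
    ← ENNReal.ofReal_mul zero_le_two, ← add_mul]
  refine ENNReal.ofReal_le_ofReal (mul_le_mul_of_nonneg_right ?_ (hF_nonneg u))
  linarith [Real.add_one_le_exp (t u), Real.add_one_le_exp (-t u)]

/-- Centring the Gaussian weight at `x` only costs `exp (-normSq x / (κ * ρ ^ 2))`, and the cross
term of the other square is odd. -/
theorem exp_mul_le_lintegral_exp {ρ κ : ℝ} (hρ : 0 < ρ) (hκ : 0 < κ) (H : Fin nR → Fin nT → ℝ)
    (x : Fin nT → ℝ) (y : Fin nR → ℝ) :
    ENNReal.ofReal (Real.exp (-normSq (y - of H *ᵥ x) / κ) * Real.exp (-normSq x / (κ * ρ ^ 2))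
        * ((√(Real.pi * κ) * ρ) ^ nT / √(gramDet ρ H)))
      ≤ ∫⁻ x', ENNReal.ofReal (Real.exp (-normSq x' / (2 * (κ * ρ ^ 2)))
          * Real.exp (-normSq (y - of H *ᵥ x') / κ)) := by
  set z := y - of H *ᵥ x with hz
  set F : (Fin nT → ℝ) → ℝ := fun u => Real.exp (-(normSq (of H *ᵥ u) + normSq u / ρ ^ 2) / κ)
  set t : (Fin nT → ℝ) → ℝ := fun u => 2 * (z ⬝ᵥ (of H *ᵥ u)) / κ
  have hF : Measurable F := Continuous.measurable (by fun_prop)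
  have ht : Measurable t := Continuous.measurable (by unfold t dotProduct; fun_prop)
  have hsymm := lintegral_le_lintegral_exp_mul (μ := volume) hF (fun u => (Real.exp_pos _).le)
    (fun u => by simp only [F, mulVec_neg, normSq_neg]) ht
    (fun u => by simp only [t, mulVec_neg, dotProduct_neg, mul_neg, neg_div])
  rw [lintegral_exp_neg_normSq_mulVec_add hρ hκ H] at hsymm
  set E := Real.exp (-normSq z / κ) * Real.exp (-normSq x / (κ * ρ ^ 2)) with hE
  rw [ENNReal.ofReal_mul (by positivity), ← lintegral_add_right_eq_self _ x]
  refine (mul_le_mul_right hsymm _).trans ?_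
  rw [← lintegral_const_mul _ (by fun_prop)]
  refine lintegral_mono fun u => ?_
  rw [← ENNReal.ofReal_mul (by positivity)]
  refine ENNReal.ofReal_le_ofReal ?_
  have hresidual : y - of H *ᵥ (u + x) = z - of H *ᵥ u := by rw [hz, mulVec_add]; abel
  simp only [hE, F, t, ← Real.exp_add, hresidual, Real.exp_le_exp]
  have hcentre : -(2 * normSq u + 2 * normSq x) / (2 * (κ * ρ ^ 2))
      ≤ -normSq (u + x) / (2 * (κ * ρ ^ 2)) :=
    div_le_div_of_nonneg_right (neg_le_neg (normSq_add_le u x)) (by positivity)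
  refine le_trans (le_of_eq ?_) (add_le_add_left hcentre _)
  rw [normSq_sub z]
  field_simp
  ring

theorem gaussianDensity_le_mixture {ρ v b : ℝ} (hρ : 0 < ρ) (hv : 0 < v)
    (H : Fin nR → Fin nT → ℝ) {x : Fin nT → ℝ} (hx : normSq x ≤ b * (2 * v * ρ ^ 2))
    (y : Fin nR → ℝ) :
    ENNReal.ofReal (gaussianDensity v (y - of H *ᵥ x))
      ≤ ENNReal.ofReal (√(gramDet ρ H) * (Real.exp b * √2 ^ nT)) *
        ∫⁻ x', ENNReal.ofReal (gaussianDensity (2 * v * ρ ^ 2) x') *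
          ENNReal.ofReal (gaussianDensity v (y - of H *ᵥ x')) := by
  have hD := gramDet_pos ρ H
  set k := (√(2 * Real.pi * v))⁻¹ ^ nR with hk
  set k' := (√(2 * Real.pi * (2 * v * ρ ^ 2)))⁻¹ ^ nT with hk'
  have hmix : ∀ x', ENNReal.ofReal (gaussianDensity (2 * v * ρ ^ 2) x') *
      ENNReal.ofReal (gaussianDensity v (y - of H *ᵥ x')) = ENNReal.ofReal (k' * k)
        * ENNReal.ofReal (Real.exp (-normSq x' / (2 * (2 * v * ρ ^ 2)))
          * Real.exp (-normSq (y - of H *ᵥ x') / (2 * v))) := fun x' => by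
    rw [← ENNReal.ofReal_mul (gaussianDensity_nonneg _ _), ← ENNReal.ofReal_mul (by positivity),
      gaussianDensity, gaussianDensity, Fintype.card_fin, Fintype.card_fin]
    congr 1
    ring
  have hnormalize : k' * (√(Real.pi * (2 * v)) * ρ) ^ nT * √2 ^ nT = 1 := by
    have hsqrt : √(2 * Real.pi * (2 * v * ρ ^ 2)) = √(Real.pi * (2 * v)) * ρ * √2 := by
      rw [show 2 * Real.pi * (2 * v * ρ ^ 2) = Real.pi * (2 * v) * ρ ^ 2 * 2 by ring,
        Real.sqrt_mul (by positivity), Real.sqrt_mul (by positivity), Real.sqrt_sq hρ.le]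
    rw [hk', ← mul_pow, ← mul_pow, hsqrt, mul_assoc, inv_mul_cancel₀ (by positivity), one_pow]
  have hexp : 1 ≤ Real.exp b * Real.exp (-normSq x / (2 * v * ρ ^ 2)) := by
    rw [← Real.exp_add, Real.one_le_exp_iff, neg_div, ← sub_eq_add_neg, sub_nonneg]
    exact (div_le_iff₀ (by positivity)).2 hx
  simp_rw [hmix]
  rw [lintegral_const_mul' _ _ ENNReal.ofReal_ne_top, ← mul_assoc,
    ← ENNReal.ofReal_mul (by positivity)]
  refine le_trans ?_ (mul_le_mul_right
    (exp_mul_le_lintegral_exp hρ (mul_pos two_pos hv) H x y) _)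
  rw [← ENNReal.ofReal_mul (by positivity), gaussianDensity, Fintype.card_fin, ← hk]
  refine ENNReal.ofReal_le_ofReal ?_
  set W := (√(Real.pi * (2 * v)) * ρ) ^ nT
  set G := Real.exp (-normSq (y - of H *ᵥ x) / (2 * v))
  calc k * G ≤ k * G * (Real.exp b * Real.exp (-normSq x / (2 * v * ρ ^ 2))) :=
        le_mul_of_one_le_right (by positivity) hexp
    _ = k * G * (Real.exp b * Real.exp (-normSq x / (2 * v * ρ ^ 2))) * (k' * W * √2 ^ nT)
          * (√(gramDet ρ H) * (√(gramDet ρ H))⁻¹) := by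
        rw [hnormalize, mul_inv_cancel₀ (by positivity), mul_one, mul_one]
    _ = _ := by ring

theorem Channel.Admissible.normSq_le {c : Channel nR nT} {ρ : ℝ} {p : Measure (Fin nT → ℝ)}
    (hp : c.Admissible ρ p) : ∀ᵐ x ∂p, normSq x ≤ nT * c.peak ρ ^ 2 := by
  filter_upwards [hp.peak] with x hx
  rw [normSq_eq_sum]
  exact (Finset.sum_le_card_nsmul _ _ (c.peak ρ ^ 2) fun i _ =>
    pow_le_pow_left₀ (hx i).1 (hx i).2 2).trans_eq (by simp)

theorem exists_mutualInfo_le (c : Channel nR nT) :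
    ∃ K : ℝ, ∀ ρ : ℝ, 0 < ρ → ∀ p, c.Admissible ρ p → ∀ H : Fin nR → Fin nT → ℝ,
      c.mutualInfo p H ≤ ENNReal.ofReal (Real.log (gramDet ρ H) / 2 + K) := by
  have hσ := c.σ_real_pos
  have hα := c.α_pos
  set b : ℝ := nT / (2 * c.α ^ 2) with hb
  refine ⟨Real.log (Real.exp b * √2 ^ nT), fun ρ hρ p hp H => ?_⟩
  have := hp.prob
  have := isProbabilityMeasure_jointXY c p H
  set v : ℝ≥0 := 2 * c.σ ^ 2 * ρ.toNNReal ^ 2 with hv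
  have hv_pos : v ≠ 0 :=
    (mul_pos (mul_pos two_pos (pow_pos c.σ_pos 2)) (pow_pos (Real.toNNReal_pos.2 hρ) 2)).ne'
  have hv_real : (v : ℝ) = 2 * (c.σ : ℝ) ^ 2 * ρ ^ 2 := by simp [hv, hρ.le]
  set γ : Measure (Fin nT → ℝ) := Measure.pi fun _ => gaussianReal 0 v with hγ
  set N : Measure (Fin nR → ℝ) := (γ.prod c.noiseVec).map fun xz => of H *ᵥ xz.1 + xz.2 with hN
  have : IsProbabilityMeasure N :=
    Measure.isProbabilityMeasure_map (measurable_addNoise H).aemeasurable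
  have hD := gramDet_pos ρ H
  rw [← Real.log_sqrt hD.le, ← Real.log_mul (by positivity) (by positivity)]
  refine (klDiv_prod_marginals_le _ N).trans (klDiv_le_of_le_smul ?_)
  rw [fst_jointXY c p H]
  refine jointXY_le_smul_prod c ?_
  filter_upwards [hp.normSq_le] with x hx
  have hxb : normSq x ≤ b * (2 * (c.σ : ℝ) ^ 2 * ρ ^ 2) := by
    refine hx.trans_eq ?_
    rw [hb, Channel.peak, Channel.avgPower]
    field_simp
  rw [map_const_add_noiseVec, hN, map_addNoise_eq_withDensity, hγ,
    pi_gaussianReal_eq_withDensity hv_pos, hv_real, ← withDensity_smul']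
  · refine withDensity_mono (ae_of_all _ fun y => ?_)
    rw [Pi.smul_apply, smul_eq_mul, lintegral_withDensity_eq_lintegral_mul _
      (Continuous.measurable (by fun_prop)).ennreal_ofReal
      (Continuous.measurable (by fun_prop)).ennreal_ofReal]
    exact gaussianDensity_le_mixture hρ (pow_pos hσ 2) H hxb y
  · exact ENNReal.ofReal_ne_top

end MutualInformation

section Likelihood

variable {nR nT l : ℕ}

/-- The square of the Frobenius norm of an `nR × l` block. -/
def frobSq (V : Fin nR → Fin l → ℝ) : ℝ := ∑ i, ∑ j, V i j ^ 2

@[fun_prop]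
theorem continuous_frobSq : Continuous (frobSq : (Fin nR → Fin l → ℝ) → ℝ) := by
  unfold frobSq; fun_prop

theorem continuous_output (nR nT l : ℕ) :
    Continuous fun p : (Fin nR → Fin nT → ℝ) × (Fin nT → Fin l → ℝ) => output p.1 p.2 := by
  refine continuous_pi fun i => continuous_pi fun j => ?_
  simp only [output, mul_apply, of_apply]
  fun_prop

@[fun_prop]
theorem measurable_output {Ω : Type*} [MeasurableSpace Ω] {H : Ω → Fin nR → Fin nT → ℝ}
    {X : Ω → Fin nT → Fin l → ℝ} (hH : Measurable H) (hX : Measurable X) :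
    Measurable fun ω => output (H ω) (X ω) :=
  (continuous_output nR nT l).measurable.comp (hH.prodMk hX)

theorem frobSq_sub_output (Y : Fin nR → Fin l → ℝ) (H : Fin nR → Fin nT → ℝ)
    (X : Fin nT → Fin l → ℝ) :
    frobSq (Y - output H X)
      = ∑ j, normSq ((fun i => Y i j) - of H *ᵥ fun t => X t j) := by
  rw [frobSq, Finset.sum_comm]
  exact Finset.sum_congr rfl fun j _ => (normSq_eq_sum _).symm

theorem likelihood_eq (c : Channel nR nT) (H : Fin nR → Fin nT → ℝ) (X : Fin nT → Fin l → ℝ)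
    (Y : Fin nR → Fin l → ℝ) :
    c.likelihood H X Y = (∏ _i : Fin nR, ∏ _j : Fin l, (√(2 * Real.pi * (c.σ : ℝ) ^ 2))⁻¹) *
      Real.exp (-frobSq (Y - output H X) / (2 * (c.σ : ℝ) ^ 2)) := by
  simp only [Channel.likelihood, gaussianPDFReal, frobSq, Pi.sub_apply, NNReal.coe_pow,
    Finset.prod_mul_distrib, ← Real.exp_sum, ← Finset.sum_div, Finset.sum_neg_distrib]

theorem likelihood_le_iff (c : Channel nR nT) (H : Fin nR → Fin nT → ℝ)
    (X X' : Fin nT → Fin l → ℝ) (Y : Fin nR → Fin l → ℝ) :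
    c.likelihood H X Y ≤ c.likelihood H X' Y ↔
      frobSq (Y - output H X') ≤ frobSq (Y - output H X) := by
  have hσ := c.σ_real_pos
  rw [likelihood_eq, likelihood_eq, mul_le_mul_iff_right₀ (by positivity), Real.exp_le_exp,
    div_le_div_iff_of_pos_right (by positivity), neg_le_neg_iff]

end Likelihood

section Chernoff

theorem prod_ofReal_exp {ι : Type*} [Fintype ι] (a : ι → ℝ) :
    ∏ i, ENNReal.ofReal (Real.exp (a i)) = ENNReal.ofReal (Real.exp (∑ i, a i)) := by
  rw [Real.exp_sum, ENNReal.ofReal_prod_of_nonneg fun i _ => (Real.exp_pos (a i)).le]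

theorem lintegral_gaussianReal_exp_sq_sub_sq {v : ℝ≥0} (hv : v ≠ 0) (a : ℝ) :
    ∫⁻ z, ENNReal.ofReal (Real.exp ((z ^ 2 - (z + a) ^ 2) / (4 * v))) ∂(gaussianReal 0 v)
      = ENNReal.ofReal (Real.exp (-a ^ 2 / (8 * v))) := by
  have hv' : (v : ℝ) ≠ 0 := NNReal.coe_ne_zero.2 hv
  set t : ℝ := -a / (2 * v) with ht
  have hsplit : ∀ z : ℝ, Real.exp ((z ^ 2 - (z + a) ^ 2) / (4 * v))
      = Real.exp (-a ^ 2 / (4 * v)) * Real.exp (t * z) := fun z => by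
    rw [← Real.exp_add, ht]
    congr 1
    field_simp
    ring
  have hmgf : ∫ z, Real.exp (t * z) ∂(gaussianReal 0 v) = Real.exp (v * t ^ 2 / 2) := by
    simpa [mgf] using congrFun (mgf_fun_id_gaussianReal (μ := 0) (v := v)) t
  simp_rw [hsplit]
  rw [← ofReal_integral_eq_lintegral_ofReal ((integrable_exp_mul_gaussianReal t).const_mul _)
    (ae_of_all _ fun z => by positivity), integral_const_mul, hmgf, ← Real.exp_add, ht]
  congr 2
  field_simp
  ring

variable {nR nT l : ℕ}

instance (c : Channel nR nT) (l : ℕ) : IsProbabilityMeasure (c.noise l) := by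
  unfold Channel.noise; infer_instance

theorem lintegral_noise_exp_frobSq_sub_frobSq (c : Channel nR nT) (V : Fin nR → Fin l → ℝ) :
    ∫⁻ z, ENNReal.ofReal (Real.exp ((frobSq z - frobSq (z + V)) / (4 * (c.σ : ℝ) ^ 2))) ∂(c.noise l)
      = ENNReal.ofReal (Real.exp (-frobSq V / (8 * (c.σ : ℝ) ^ 2))) := by
  have hσ : c.σ ^ 2 ≠ 0 := (pow_pos c.σ_pos 2).ne'
  have hfactor : ∀ z : Fin nR → Fin l → ℝ,
      ENNReal.ofReal (Real.exp ((frobSq z - frobSq (z + V)) / (4 * (c.σ : ℝ) ^ 2)))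
        = ∏ i, ∏ j, ENNReal.ofReal (Real.exp
            ((z i j ^ 2 - (z i j + V i j) ^ 2) / (4 * (c.σ ^ 2 : ℝ≥0)))) := fun z => by
    simp only [prod_ofReal_exp, ← Finset.sum_div, Finset.sum_sub_distrib, frobSq, Pi.add_apply,
      NNReal.coe_pow]
  simp_rw [hfactor]
  rw [Channel.noise, lintegral_pi_prod (f := fun i (y : Fin l → ℝ) => ∏ j, ENNReal.ofReal (Real.exp
    ((y j ^ 2 - (y j + V i j) ^ 2) / (4 * (c.σ ^ 2 : ℝ≥0))))) fun _ => by fun_prop]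
  simp_rw [fun i => lintegral_pi_prod (μ := fun _ : Fin l => gaussianReal 0 (c.σ ^ 2))
    (f := fun j (y : ℝ) => ENNReal.ofReal (Real.exp
      ((y ^ 2 - (y + V i j) ^ 2) / (4 * (c.σ ^ 2 : ℝ≥0))))) fun _ => by fun_prop,
    lintegral_gaussianReal_exp_sq_sub_sq hσ, prod_ofReal_exp, ← Finset.sum_div,
    Finset.sum_neg_distrib, NNReal.coe_pow, frobSq]

theorem noise_likelihood_le_le (c : Channel nR nT) (H : Fin nR → Fin nT → ℝ)
    (X X' : Fin nT → Fin l → ℝ) :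
    c.noise l {z | c.likelihood H X (output H X + z) ≤ c.likelihood H X' (output H X + z)} ≤
      ENNReal.ofReal (Real.exp (-frobSq (output H X - output H X') / (8 * (c.σ : ℝ) ^ 2))) := by
  rw [← lintegral_noise_exp_frobSq_sub_frobSq]
  refine le_trans (measure_mono fun z hz => ?_)
    ((one_mul _).ge.trans (mul_meas_ge_le_lintegral (by fun_prop) 1))
  rw [Set.mem_ofPred_eq, likelihood_le_iff, add_sub_cancel_left, add_sub_right_comm, add_comm] at hz
  exact ENNReal.one_le_ofReal.2 (Real.one_le_exp (div_nonneg (sub_nonneg.2 hz) (by positivity)))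

end Chernoff

section ErrorProbability

variable {nR nT l : ℕ}

/-- The law of one codeword of the random code. -/
noncomputable def Channel.codeword (c : Channel nR nT) (l : ℕ) (m ρ : ℝ) :
    Measure (Fin nT → Fin l → ℝ) :=
  Measure.pi fun _ => Measure.pi fun _ => truncExp (c.peak ρ) m

theorem isProbabilityMeasure_codeword (c : Channel nR nT) (l : ℕ) (m : ℝ) {ρ : ℝ} (hρ : 0 < ρ) :
    IsProbabilityMeasure (c.codeword l m ρ) := by
  have := isProbabilityMeasure_truncExp (c.peak_pos hρ) m
  unfold Channel.codeword
  infer_instance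

theorem exists_lintegral_codeword_exp_le (c : Channel nR nT) (l : ℕ) (m : ℝ) :
    ∃ C : ℝ, 0 < C ∧ ∀ ρ : ℝ, 0 < ρ → ∀ (H : Fin nR → Fin nT → ℝ) (Y : Fin nR → Fin l → ℝ),
      ∫⁻ X, ENNReal.ofReal (Real.exp (-frobSq (Y - output H X) / (8 * (c.σ : ℝ) ^ 2)))
        ∂(c.codeword l m ρ) ≤ ENNReal.ofReal ((C / √(gramDet ρ H)) ^ l) := by
  have hσ := c.σ_real_pos
  obtain ⟨C, hC, h⟩ := exists_lintegral_teInput_exp_le c m (κ := 8 * (c.σ : ℝ) ^ 2) (by positivity)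
  refine ⟨C, hC, fun ρ hρ H Y => ?_⟩
  have := isProbabilityMeasure_truncExp (c.peak_pos hρ) m
  have := isProbabilityMeasure_teInput c m hρ
  have hcolumns : c.codeword l m ρ = (Measure.pi fun _ : Fin l => c.teInput m ρ).map
      fun x j i => x i j :=
    (map_swap_pi_pi fun (_ : Fin l) (_ : Fin nT) => truncExp (c.peak ρ) m).symm
  rw [hcolumns, lintegral_map (by fun_prop) (by fun_prop)]
  simp_rw [frobSq_sub_output, ← Finset.sum_neg_distrib, Finset.sum_div, ← prod_ofReal_exp]
  rw [lintegral_pi_prod (f := fun j x => ENNReal.ofReal (Real.exp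
    (-normSq ((fun i => Y i j) - of H *ᵥ x) / (8 * (c.σ : ℝ) ^ 2)))) fun _ => by fun_prop]
  refine (Finset.prod_le_prod' fun j _ => h ρ hρ H fun i => Y i j).trans_eq ?_
  rw [Finset.prod_const, Finset.card_univ, Fintype.card_fin, ENNReal.ofReal_pow (by positivity)]

/-- The event that, when message `k` is sent, message `k'` is at least as likely. The sample is made
of the channel matrix, the codebook and the noise. -/
def Channel.confusion (c : Channel nR nT) (l : ℕ) {M : ℕ} (k k' : Fin M) :
    Set ((Fin nR → Fin nT → ℝ) × (Fin M → Fin nT → Fin l → ℝ) × (Fin nR → Fin l → ℝ)) :=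
  {ω | c.likelihood ω.1 (ω.2.1 k) (output ω.1 (ω.2.1 k) + ω.2.2)
    ≤ c.likelihood ω.1 (ω.2.1 k') (output ω.1 (ω.2.1 k) + ω.2.2)}

theorem measurableSet_confusion (c : Channel nR nT) (l : ℕ) {M : ℕ} (k k' : Fin M) :
    MeasurableSet (c.confusion l k k') := by
  simp only [Channel.confusion, likelihood_le_iff]
  exact measurableSet_le (by fun_prop) (by fun_prop)

theorem exists_prod_confusion_le (c : Channel nR nT) (l : ℕ) (m : ℝ) :
    ∃ C : ℝ, 0 < C ∧ ∀ ρ : ℝ, 0 < ρ → ∀ (M : ℕ) (H : Fin nR → Fin nT → ℝ) (k k' : Fin M), k' ≠ k →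
      ((Measure.pi fun _ : Fin M => c.codeword l m ρ).prod (c.noise l))
        (Prod.mk H ⁻¹' c.confusion l k k') ≤ ENNReal.ofReal ((C / √(gramDet ρ H)) ^ l) := by
  obtain ⟨C, hC, h⟩ := exists_lintegral_codeword_exp_le c l m
  refine ⟨C, hC, fun ρ hρ M H k k' hkk => ?_⟩
  have := isProbabilityMeasure_codeword c l m hρ
  rw [Measure.prod_apply (measurable_prodMk_left (measurableSet_confusion c l k k'))]
  have hchernoff : ∀ X : Fin M → Fin nT → Fin l → ℝ,
      c.noise l (Prod.mk X ⁻¹' (Prod.mk H ⁻¹' c.confusion l k k')) ≤ ENNReal.ofReal (Real.exp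
        (-frobSq (output H (X k) - output H (X k')) / (8 * (c.σ : ℝ) ^ 2))) :=
    fun X => noise_likelihood_le_le c H (X k) (X k')
  refine (lintegral_mono hchernoff).trans
    (lintegral_pi_le_of_forall_update (by fun_prop) k' fun X => ?_)
  simp only [Function.update_self, Function.update_of_ne hkk.symm]
  exact h ρ hρ H _

theorem exists_prod_error_le (c : Channel nR nT) (l : ℕ) (m : ℝ) :
    ∃ C : ℝ, 0 < C ∧ ∀ ρ : ℝ, 0 < ρ → ∀ (M : ℕ) (δ : Decoder nR nT l M),
      c.IsML δ → ∀ S : Set (Fin nR → Fin nT → ℝ), MeasurableSet S → ∀ k : Fin M,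
      (c.lawH.prod ((Measure.pi fun _ : Fin M => c.codeword l m ρ).prod (c.noise l)))
        {ω | δ ω.1 ω.2.1 (output ω.1 (ω.2.1 k) + ω.2.2) ≠ k} ≤ c.lawH S + ((M - 1 : ℕ) : ℝ≥0∞) *
        ∫⁻ H in Sᶜ, ENNReal.ofReal ((C / √(gramDet ρ H)) ^ l) ∂c.lawH := by
  obtain ⟨C, hC, h⟩ := exists_prod_confusion_le c l m
  refine ⟨C, hC, fun ρ hρ M δ hδ S hS k => ?_⟩
  have := isProbabilityMeasure_codeword c l m hρ
  set Q := (Measure.pi fun _ : Fin M => c.codeword l m ρ).prod (c.noise l)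
  set I := ∫⁻ H in Sᶜ, ENNReal.ofReal ((C / √(gramDet ρ H)) ^ l) ∂c.lawH with hI
  have hpair : ∀ k' ∈ Finset.univ.erase k,
      c.lawH.prod Q (Prod.fst ⁻¹' Sᶜ ∩ c.confusion l k k') ≤ I := fun k' hk' => by
    rw [Measure.prod_apply ((measurable_fst hS.compl).inter (measurableSet_confusion c l k k')), hI,
      ← lintegral_indicator hS.compl]
    refine lintegral_mono fun H => ?_
    by_cases hH : H ∈ Sᶜ
    · rw [Set.indicator_of_mem hH]
      exact (measure_mono fun ω hω => hω.2).trans (h ρ hρ M H k k' (Finset.ne_of_mem_erase hk'))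
    · exact (measure_mono_null (fun ω hω => hH hω.1) measure_empty).trans_le zero_le
  have hsub : {ω | δ ω.1 ω.2.1 (output ω.1 (ω.2.1 k) + ω.2.2) ≠ k} ⊆ S ×ˢ Set.univ ∪
      ⋃ k' ∈ Finset.univ.erase k, Prod.fst ⁻¹' Sᶜ ∩ c.confusion l k k' := fun ω hω => by
    by_cases hS : ω.1 ∈ S
    · exact Or.inl ⟨hS, trivial⟩
    · exact Or.inr (Set.mem_biUnion (Finset.mem_coe.2 (Finset.mem_erase.2 ⟨hω, Finset.mem_univ _⟩))
        ⟨hS, hδ ω.1 ω.2.1 _ k⟩)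
  refine (measure_mono hsub).trans ((measure_union_le _ _).trans (add_le_add ?_ ?_))
  · rw [Measure.prod_prod, measure_univ, mul_one]
  · refine (measure_biUnion_finset_le _ _).trans
      ((Finset.sum_le_card_nsmul _ _ I hpair).trans_eq ?_)
    rw [nsmul_eq_mul, Finset.card_erase_of_mem (Finset.mem_univ k), Finset.card_univ,
      Fintype.card_fin]

theorem codeSize_sub_one_le (l : ℕ) (r : ℝ) {ρ : ℝ} (hρ : 0 < ρ) :
    ((codeSize l r ρ - 1 : ℕ) : ℝ≥0∞) ≤ ENNReal.ofReal (ρ ^ ((l : ℝ) * r)) := by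
  have hpos : 0 ≤ ρ ^ ((l : ℝ) * r) := (Real.rpow_pos_of_pos hρ _).le
  rw [← ENNReal.ofReal_natCast]
  refine ENNReal.ofReal_le_ofReal ?_
  rw [codeSize, Nat.cast_sub (le_max_left _ _), Nat.cast_one, sub_le_iff_le_add, Nat.cast_max]
  exact max_le (by simpa using hpos) (Nat.ceil_lt_add_one hpos).le

theorem exists_Pe_le (c : Channel nR nT) (l : ℕ) (m : ℝ) :
    ∃ C : ℝ, 0 < C ∧ ∀ ρ : ℝ, 0 < ρ → ∀ (r : ℝ) (δ : Decoder nR nT l (codeSize l r ρ)),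
      c.IsML δ → ∀ S : Set (Fin nR → Fin nT → ℝ), MeasurableSet S →
      c.Pe l m r ρ δ ≤ c.lawH S + ENNReal.ofReal (ρ ^ ((l : ℝ) * r)) *
        ∫⁻ H in Sᶜ, ENNReal.ofReal ((C / √(gramDet ρ H)) ^ l) ∂c.lawH := by
  obtain ⟨C, hC, h⟩ := exists_prod_error_le c l m
  refine ⟨C, hC, fun ρ hρ r δ hδ S hS => ENNReal.div_le_of_le_mul ?_⟩
  refine (Finset.sum_le_card_nsmul _ _ _ fun k _ => (h ρ hρ _ δ hδ S hS k).trans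
    (add_le_add le_rfl (mul_le_mul_left (codeSize_sub_one_le l r hρ) _))).trans_eq ?_
  rw [nsmul_eq_mul, Finset.card_univ, Fintype.card_fin, mul_comm]

end ErrorProbability

section BesselFunction

theorem cosh_le_exp_abs (x : ℝ) : Real.cosh x ≤ Real.exp |x| := by
  rw [← Real.cosh_abs, Real.cosh_eq]
  linarith [Real.exp_le_exp.2 (neg_le_self (abs_nonneg x))]

theorem sq_div_four_le_cosh (x : ℝ) : x ^ 2 / 4 ≤ Real.cosh x := by
  rw [← Real.cosh_abs, ← sq_abs, Real.cosh_eq]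
  linarith [Real.quadratic_le_exp_of_nonneg (abs_nonneg x), Real.exp_pos (-|x|), abs_nonneg x]

theorem integrableOn_besselK (τ : ℝ) {x : ℝ} (hx : 0 < x) :
    IntegrableOn (fun t => Real.exp (-x * Real.cosh t) * Real.cosh (τ * t)) (Set.Ioi 0) := by
  have hdom : IntegrableOn (fun t : ℝ => Real.exp (2 * τ ^ 2 / x) * Real.exp (-(x / 8) * t ^ 2))
      (Set.Ioi 0) := ((integrable_exp_neg_mul_sq (by positivity)).const_mul _).integrableOn
  have hcont : Continuous fun t : ℝ => Real.exp (-x * Real.cosh t) * Real.cosh (τ * t) := by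
    fun_prop
  refine Integrable.mono' hdom hcont.aestronglyMeasurable (ae_of_all _ fun t => ?_)
  have hsquare : |τ * t| - x * (t ^ 2 / 4) ≤ 2 * τ ^ 2 / x - x / 8 * t ^ 2 := by
    have h : 2 * τ ^ 2 / x - x / 8 * t ^ 2 - (|τ * t| - x * (t ^ 2 / 4))
        = (x * |t| - 4 * |τ|) ^ 2 / (8 * x) := by
      rw [abs_mul, ← sq_abs τ, ← sq_abs t]
      field_simp
      ring
    have : 0 ≤ (x * |t| - 4 * |τ|) ^ 2 / (8 * x) := by positivity
    linarith
  rw [Real.norm_of_nonneg (mul_nonneg (Real.exp_pos _).le (Real.cosh_pos _).le)]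
  calc Real.exp (-x * Real.cosh t) * Real.cosh (τ * t)
      ≤ Real.exp (-x * Real.cosh t) * Real.exp |τ * t| := by
        gcongr
        exact cosh_le_exp_abs _
    _ ≤ Real.exp (2 * τ ^ 2 / x) * Real.exp (-(x / 8) * t ^ 2) := by
        rw [← Real.exp_add, ← Real.exp_add]
        refine Real.exp_le_exp.2 ?_
        linarith [mul_le_mul_of_nonneg_left (sq_div_four_le_cosh t) hx.le]

theorem besselK_le_besselK (τ : ℝ) {x y : ℝ} (hx : 0 < x) (hxy : x ≤ y) :
    besselK τ y ≤ besselK τ x := by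
  refine setIntegral_mono_on (integrableOn_besselK τ (hx.trans_le hxy))
    (integrableOn_besselK τ hx) measurableSet_Ioi fun t _ => ?_
  have := Real.cosh_pos t
  have := Real.cosh_pos (τ * t)
  gcongr

end BesselFunction

section TurbulenceDensities

theorem pdf_negExp_le {s : ℝ} (hs : s ≤ 1) {x : ℝ} (hx : 0 ≤ x) :
    Turbulence.negExp.pdf x ≤ Turbulence.negExp.pdf (s * x) :=
  Real.exp_le_exp.2 (neg_le_neg (mul_le_of_le_one_left hx hs))

theorem pdf_gammaGamma_le {ρ₁ ρ₂ : ℝ} (h0 : 0 < ρ₂) (h1 : ρ₂ < ρ₁) {s : ℝ} (hs : 0 < s)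
    (hs1 : s ≤ 1) {x : ℝ} (hx : 0 < x) :
    (Turbulence.gammaGamma ρ₁ ρ₂ h0 h1).pdf x
      ≤ s ^ (1 - (ρ₁ + ρ₂) / 2) * (Turbulence.gammaGamma ρ₁ ρ₂ h0 h1).pdf (s * x) := by
  have hρ₁ : 0 < ρ₁ := h0.trans h1
  have := Real.Gamma_pos_of_pos hρ₁
  have := Real.Gamma_pos_of_pos h0
  have hpow : s ^ (1 - (ρ₁ + ρ₂) / 2) * (s * x) ^ ((ρ₁ + ρ₂) / 2 - 1)
      = x ^ ((ρ₁ + ρ₂) / 2 - 1) := by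
    rw [Real.mul_rpow hs.le hx.le, ← mul_assoc, ← Real.rpow_add hs, sub_add_sub_cancel', sub_self,
      Real.rpow_zero, one_mul]
  have hbessel : besselK (ρ₁ - ρ₂) (2 * √(ρ₁ * ρ₂ * x))
      ≤ besselK (ρ₁ - ρ₂) (2 * √(ρ₁ * ρ₂ * (s * x))) := by
    refine besselK_le_besselK _ (by positivity) ?_
    gcongr
    exact mul_le_of_le_one_left hx.le hs1
  simp only [Turbulence.pdf]
  set A := 2 * (ρ₁ * ρ₂) ^ ((ρ₁ + ρ₂) / 2) / (Real.Gamma ρ₁ * Real.Gamma ρ₂)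
  calc A * x ^ ((ρ₁ + ρ₂) / 2 - 1) * besselK (ρ₁ - ρ₂) (2 * √(ρ₁ * ρ₂ * x))
      ≤ A * x ^ ((ρ₁ + ρ₂) / 2 - 1) * besselK (ρ₁ - ρ₂) (2 * √(ρ₁ * ρ₂ * (s * x))) := by gcongr
    _ = s ^ (1 - (ρ₁ + ρ₂) / 2) * (A * (s * x) ^ ((ρ₁ + ρ₂) / 2 - 1)
          * besselK (ρ₁ - ρ₂) (2 * √(ρ₁ * ρ₂ * (s * x)))) := by
        rw [← hpow]
        ring

variable {μl σl : ℝ}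

theorem pdf_logNormal_eq (h0 : 0 < σl) {x : ℝ} (hx : 0 < x) :
    (Turbulence.logNormal μl σl h0).pdf x = (√(2 * Real.pi * σl ^ 2))⁻¹
      * Real.exp (-Real.log x - (Real.log x - μl) ^ 2 / (2 * σl ^ 2)) := by
  simp only [Turbulence.pdf]
  rw [Real.exp_sub, Real.exp_neg, Real.exp_log hx, neg_div, Real.exp_neg, one_div, mul_inv]
  ring

theorem pdf_logNormal_eq_mul (h0 : 0 < σl) {s x : ℝ} (hs : 0 < s) (hx : 0 < x) :
    (Turbulence.logNormal μl σl h0).pdf x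
      = Real.exp (Real.log s + (Real.log s ^ 2 - 2 * Real.log s * μl) / (2 * σl ^ 2))
        * x ^ (Real.log s / σl ^ 2) * (Turbulence.logNormal μl σl h0).pdf (s * x) := by
  rw [pdf_logNormal_eq h0 hx, pdf_logNormal_eq h0 (mul_pos hs hx), mul_left_comm,
    Real.rpow_def_of_pos hx, ← Real.exp_add, ← Real.exp_add, Real.log_mul hs.ne' hx.ne']
  congr 2
  field_simp
  ring

theorem exists_pdf_logNormal_le_mul (h0 : 0 < σl) {s : ℝ} (hs : 0 < s) (hs1 : s ≤ 1) :
    ∃ C : ℝ, 0 < C ∧ ∀ τ x, 0 < τ → τ ≤ x → (Turbulence.logNormal μl σl h0).pdf x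
      ≤ C * τ ^ (Real.log s / σl ^ 2) * (Turbulence.logNormal μl σl h0).pdf (s * x) := by
  refine ⟨Real.exp (Real.log s + (Real.log s ^ 2 - 2 * Real.log s * μl) / (2 * σl ^ 2)),
    Real.exp_pos _, fun τ x hτ hx => ?_⟩
  rw [pdf_logNormal_eq_mul h0 hs (hτ.trans_le hx)]
  have hpdf : 0 ≤ (Turbulence.logNormal μl σl h0).pdf (s * x) := by
    rw [pdf_logNormal_eq h0 (mul_pos hs (hτ.trans_le hx))]
    positivity
  have hexp : Real.log s / σl ^ 2 ≤ 0 :=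
    div_nonpos_of_nonpos_of_nonneg (Real.log_nonpos hs.le hs1) (sq_nonneg σl)
  gcongr ?_ * ?_ * _
  exact Real.rpow_le_rpow_of_nonpos hτ hx hexp

theorem exists_pdf_logNormal_le_rpow (h0 : 0 < σl) (q : ℝ) :
    ∃ C : ℝ, 0 < C ∧ ∀ x, 0 < x → (Turbulence.logNormal μl σl h0).pdf x ≤ C * x ^ q := by
  refine ⟨(√(2 * Real.pi * σl ^ 2))⁻¹ * Real.exp (-(q + 1) * μl + (q + 1) ^ 2 * σl ^ 2 / 2),
    by positivity, fun x hx => ?_⟩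
  rw [pdf_logNormal_eq h0 hx, Real.rpow_def_of_pos hx, mul_assoc (√(2 * Real.pi * σl ^ 2))⁻¹,
    ← Real.exp_add]
  gcongr
  have hsquare : 0 ≤ ((Real.log x - μl) / σl + (q + 1) * σl) ^ 2 / 2 := by positivity
  have : ((Real.log x - μl) / σl + (q + 1) * σl) ^ 2 / 2 = (Real.log x - μl) ^ 2 / (2 * σl ^ 2)
      + (q + 1) * (Real.log x - μl) + (q + 1) ^ 2 * σl ^ 2 / 2 := by
    field_simp
    ring
  linarith

end TurbulenceDensities

section TurbulenceLaw

instance (t : Turbulence) : SigmaFinite t.law := by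
  unfold Turbulence.law; infer_instance

theorem law_apply (t : Turbulence) {A : Set ℝ} (hA : MeasurableSet A) :
    t.law A = ∫⁻ x in A ∩ Set.Ioi 0, ENNReal.ofReal (t.pdf x) := by
  rw [Turbulence.law, withDensity_apply _ hA, Measure.restrict_restrict hA]

theorem law_absolutelyContinuous (t : Turbulence) : t.law ≪ volume :=
  (withDensity_absolutelyContinuous _ _).trans Measure.absolutelyContinuous_restrict

theorem restrict_law_le_smul_map {t : Turbulence} {s C : ℝ} (hs : 0 < s) (hC : 0 ≤ C) {U : Set ℝ}
    (hU : MeasurableSet U) (h : ∀ x ∈ U, 0 < x → t.pdf x ≤ C * t.pdf (s * x)) :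
    t.law.restrict U ≤ (C / s).toNNReal • t.law.map (s⁻¹ • ·) := by
  refine Measure.le_iff.2 fun A hA => ?_
  have hdil : Measurable fun x : ℝ => s⁻¹ • x := measurable_const_smul _
  have hpreimage : (s * ·) ⁻¹' ((s⁻¹ • ·) ⁻¹' A ∩ Set.Ioi 0) = A ∩ Set.Ioi 0 := by
    ext x
    simp [hs.ne', hs]
  have hmap : MeasurePreserving (s * ·) volume (ENNReal.ofReal s⁻¹ • volume : Measure ℝ) :=
    ⟨measurable_const_mul s, by rw [Real.map_volume_mul_left hs.ne', abs_of_pos (inv_pos.2 hs)]⟩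
  change t.law.restrict U A ≤ ENNReal.ofReal (C / s) * t.law.map (s⁻¹ • ·) A
  rw [Measure.restrict_apply hA, Measure.map_apply hdil hA, law_apply t (hA.inter hU),
    law_apply t (hdil hA)]
  calc ∫⁻ x in A ∩ U ∩ Set.Ioi 0, ENNReal.ofReal (t.pdf x)
      ≤ ∫⁻ x in A ∩ U ∩ Set.Ioi 0, ENNReal.ofReal C * ENNReal.ofReal (t.pdf (s * x)) := by
        refine setLIntegral_mono' ((hA.inter hU).inter measurableSet_Ioi) fun x hx => ?_
        rw [← ENNReal.ofReal_mul hC]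
        exact ENNReal.ofReal_le_ofReal (h x hx.1.2 hx.2)
    _ ≤ ∫⁻ x in A ∩ Set.Ioi 0, ENNReal.ofReal C * ENNReal.ofReal (t.pdf (s * x)) :=
        lintegral_mono_set (Set.inter_subset_inter_left _ Set.inter_subset_left)
    _ = ENNReal.ofReal (C / s)
          * ∫⁻ y in (s⁻¹ • ·) ⁻¹' A ∩ Set.Ioi 0, ENNReal.ofReal (t.pdf y) := by
        rw [lintegral_const_mul' _ _ ENNReal.ofReal_ne_top, ← hpreimage,
          hmap.setLIntegral_comp_preimage_emb (measurableEmbedding_mulLeft₀ hs.ne')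
            (fun y => ENNReal.ofReal (t.pdf y)), Measure.restrict_smul, lintegral_smul_measure,
          smul_eq_mul, ← mul_assoc, ← ENNReal.ofReal_mul hC, div_eq_mul_inv]

variable {μl σl : ℝ}

theorem exists_law_logNormal_Iio_le (h0 : 0 < σl) {q : ℝ} (hq : 0 ≤ q) :
    ∃ C : ℝ, 0 < C ∧ ∀ τ, 0 < τ → τ ≤ 1 →
      (Turbulence.logNormal μl σl h0).law (Set.Iio τ) ≤ ENNReal.ofReal (C * τ ^ q) := by
  obtain ⟨C, hC, h⟩ := exists_pdf_logNormal_le_rpow (μl := μl) h0 q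
  refine ⟨C, hC, fun τ _ hτ1 => ?_⟩
  rw [law_apply _ measurableSet_Iio, Set.Iio_inter_Ioi]
  calc ∫⁻ x in Set.Ioo 0 τ, ENNReal.ofReal ((Turbulence.logNormal μl σl h0).pdf x)
      ≤ ∫⁻ _ in Set.Ioo 0 τ, ENNReal.ofReal (C * τ ^ q) := by
        refine setLIntegral_mono' measurableSet_Ioo fun x hx =>
          ENNReal.ofReal_le_ofReal ((h x hx.1).trans ?_)
        have := hx.1.le
        have := hx.2.le
        gcongr
    _ = ENNReal.ofReal (C * τ ^ q) * ENNReal.ofReal τ := by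
        rw [setLIntegral_const, Real.volume_Ioo, sub_zero]
    _ ≤ ENNReal.ofReal (C * τ ^ q) := mul_le_of_le_one_right' (ENNReal.ofReal_le_one.2 hτ1)

theorem isFiniteMeasure_law_logNormal (h0 : 0 < σl) :
    IsFiniteMeasure (Turbulence.logNormal μl σl h0).law := by
  obtain ⟨C, -, h⟩ := exists_pdf_logNormal_le_rpow (μl := μl) h0 (-2)
  obtain ⟨_, -, hnear⟩ := exists_law_logNormal_Iio_le (μl := μl) h0 (q := 0) le_rfl
  have hint : IntegrableOn (fun x : ℝ => C * x ^ (-2 : ℝ)) (Set.Ici 1) := by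
    rw [integrableOn_Ici_iff_integrableOn_Ioi]
    exact (integrableOn_Ioi_rpow_of_lt (by norm_num) one_pos).const_mul C
  have hpos : Set.Ici (1 : ℝ) ⊆ Set.Ioi 0 := Set.Ici_subset_Ioi.2 one_pos
  have hfar : (Turbulence.logNormal μl σl h0).law (Set.Ici 1) < ∞ := by
    rw [law_apply _ measurableSet_Ici, Set.inter_eq_left.2 hpos]
    exact (setLIntegral_mono' measurableSet_Ici fun x hx =>
      ENNReal.ofReal_le_ofReal (h x (hpos hx))).trans_lt hint.lintegral_lt_top
  refine ⟨?_⟩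
  rw [← Set.Iio_union_Ici (a := (1 : ℝ))]
  exact (measure_union_le _ _).trans_lt (ENNReal.add_lt_top.2
    ⟨(hnear 1 one_pos le_rfl).trans_lt ENNReal.ofReal_lt_top, hfar⟩)

end TurbulenceLaw

section ArrayLaws

variable {ι κ E : Type*} [Fintype ι] [Fintype κ] [MeasurableSpace E] {μ : Measure E}
  [SigmaFinite μ]

theorem pi_pi_le_smul_map_add {f : E → E} (hf : Measurable f) [SigmaFinite (μ.map f)] {U : Set E}
    {K : ℝ≥0} (hK : K ≠ 0) (h : μ.restrict U ≤ K • μ.map f) {S : Set (ι → κ → E)}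
    (hS : MeasurableSet S) :
    Measure.pi (fun _ => Measure.pi fun _ => μ) S
      ≤ K ^ (Fintype.card ι * Fintype.card κ)
          * Measure.pi (fun _ => Measure.pi fun _ => μ) ((fun H i j => f (H i j)) ⁻¹' S)
        + Measure.pi (fun _ : ι => Measure.pi fun _ : κ => μ) {H | ∃ i j, H i j ∈ Uᶜ} := by
  set P : Measure (ι → κ → E) := Measure.pi fun _ => Measure.pi fun _ => μ
  have hrow : (Measure.pi fun _ : κ => μ).restrict (Set.univ.pi fun _ => U)
      ≤ (∏ _j : κ, K) • (Measure.pi fun _ : κ => μ).map fun x j => f (x j) :=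
    pi_restrict_le_smul_map (fun _ => hf) (fun _ => hK) fun _ => h
  have : SigmaFinite ((Measure.pi fun _ : κ => μ).map fun x j => f (x j)) := by
    rw [Measure.pi_map_pi fun _ => hf.aemeasurable]
    infer_instance
  have hfrow : Measurable fun (x : κ → E) j => f (x j) := by fun_prop
  have hbox : P.restrict (Set.univ.pi fun _ => Set.univ.pi fun _ => U)
      ≤ (∏ _i : ι, ∏ _j : κ, K) • P.map fun H i j => f (H i j) :=
    pi_restrict_le_smul_map (fun _ => hfrow)
      (fun _ => Finset.prod_ne_zero_iff.2 fun _ _ => hK) fun _ => hrow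
  have hsplit : S ⊆ S ∩ (Set.univ.pi fun _ => Set.univ.pi fun _ => U)
      ∪ {H | ∃ i j, H i j ∈ Uᶜ} := fun H hH => by
    by_cases hU : ∃ i j, H i j ∈ Uᶜ
    · exact Or.inr hU
    · exact Or.inl ⟨hH, by simpa [Set.mem_pi] using hU⟩
  refine (measure_mono hsplit).trans ((measure_union_le _ _).trans (add_le_add_left ?_ _))
  rw [← Measure.restrict_apply hS]
  refine (hbox S).trans_eq ?_
  rw [Measure.smul_apply, Measure.map_apply (by fun_prop) hS, ENNReal.smul_def, smul_eq_mul]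
  simp only [Finset.prod_const, Finset.card_univ, ← pow_mul, mul_comm, ENNReal.coe_pow]

theorem exists_pi_pi_exists_mem_le [IsFiniteMeasure μ] :
    ∃ K : ℝ≥0, ∀ W, MeasurableSet W →
      Measure.pi (fun _ : ι => Measure.pi fun _ : κ => μ) {H | ∃ i j, H i j ∈ W} ≤ K * μ W := by
  set ν : Measure (κ → E) := Measure.pi fun _ => μ
  set a : ℝ≥0∞ := Fintype.card ι * ν Set.univ ^ (Fintype.card ι - 1)
  set b : ℝ≥0∞ := Fintype.card κ * μ Set.univ ^ (Fintype.card κ - 1)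
  have ha : a ≠ ∞ := by finiteness
  have hb : b ≠ ∞ := by finiteness
  refine ⟨(a * b).toNNReal, fun W hW => ?_⟩
  rw [ENNReal.coe_toNNReal (ENNReal.mul_ne_top ha hb)]
  have hW' : MeasurableSet {x : κ → E | ∃ j, x j ∈ W} := by
    simp only [Set.ofPred_exists]
    exact MeasurableSet.iUnion fun j => measurable_pi_apply j hW
  calc Measure.pi (fun _ : ι => ν) {H | ∃ i, H i ∈ {x : κ → E | ∃ j, x j ∈ W}}
      ≤ a * ν {x | ∃ j, x j ∈ W} := (pi_exists_mem_le ν hW').trans_eq (mul_assoc _ _ _).symm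
    _ ≤ a * (b * μ W) := by
        gcongr
        exact (pi_exists_mem_le μ hW).trans_eq (mul_assoc _ _ _).symm
    _ = a * b * μ W := (mul_assoc _ _ _).symm

end ArrayLaws

section ChannelLaw

/-- Up to an additive error of arbitrarily high order in `τ`, the dilation by `s⁻¹` changes the
measure `P` at most by a factor polynomial in `τ⁻¹`. The error term is needed for log-normal laws,
whose density ratio under a dilation is unbounded near `0`. -/
def HasDilationBound {E : Type*} [MeasurableSpace E] [SMul ℝ E] (P : Measure E) (s : ℝ) : Prop :=
  ∃ κ : ℝ, 0 ≤ κ ∧ ∀ q : ℝ, 0 ≤ q → ∃ C : ℝ, 0 < C ∧ ∀ τ, 0 < τ → τ ≤ 1 →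
    ∀ S : Set E, MeasurableSet S →
      P S ≤ ENNReal.ofReal (C * τ ^ (-κ)) * P ((s⁻¹ • ·) ⁻¹' S) + ENNReal.ofReal (C * τ ^ q)

/-- The law of an array of i.i.d. turbulence intensities, before attenuation. -/
noncomputable def Turbulence.arrayLaw (t : Turbulence) (nR nT : ℕ) :
    Measure (Fin nR → Fin nT → ℝ) :=
  Measure.pi fun _ => Measure.pi fun _ => t.law

variable {nR nT : ℕ}

/-- The channel matrix with entries `exp (-ν d i j) * hr i j` obtained from the turbulence
intensities `hr`. -/
noncomputable def Channel.attenuate (c : Channel nR nT) (H : Fin nR → Fin nT → ℝ) :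
    Fin nR → Fin nT → ℝ :=
  fun i j => Real.exp (-(c.ν * c.d i j)) * H i j

theorem measurable_attenuate (c : Channel nR nT) : Measurable c.attenuate := by
  unfold Channel.attenuate
  fun_prop

instance (c : Channel nR nT) (i : Fin nR) (j : Fin nT) :
    SigmaFinite (c.turbulence.law.map fun x => Real.exp (-(c.ν * c.d i j)) * x) :=
  (MeasurableEquiv.mulLeft₀ _ (Real.exp_ne_zero _)).sigmaFinite_map

theorem lawH_eq_map_attenuate (c : Channel nR nT) :
    c.lawH = (c.turbulence.arrayLaw nR nT).map c.attenuate := by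
  have hrow (i : Fin nR) : (Measure.pi fun _ : Fin nT => c.turbulence.law).map
      (fun x j => Real.exp (-(c.ν * c.d i j)) * x j)
      = Measure.pi fun j => c.turbulence.law.map fun x => Real.exp (-(c.ν * c.d i j)) * x :=
    Measure.pi_map_pi fun j => (measurable_const_mul _).aemeasurable
  have (i : Fin nR) : SigmaFinite ((Measure.pi fun _ : Fin nT => c.turbulence.law).map
      fun x j => Real.exp (-(c.ν * c.d i j)) * x j) := by
    rw [hrow]
    infer_instance
  have hmeas (i : Fin nR) : Measurable fun (x : Fin nT → ℝ) j =>
      Real.exp (-(c.ν * c.d i j)) * x j := by fun_prop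
  simp only [Channel.lawH, ← hrow]
  exact (Measure.pi_map_pi fun i => (hmeas i).aemeasurable).symm

theorem ae_eig_pos (c : Channel nR nT) (hn : nR ≤ nT) : ∀ᵐ H ∂c.lawH, ∀ i, 0 < eig H i := by
  have hentry (i : Fin nR) (j : Fin nT) :
      c.turbulence.law.map (fun x => Real.exp (-(c.ν * c.d i j)) * x) ≪ volume := by
    refine ((law_absolutelyContinuous _).map (measurable_const_mul _)).trans ?_
    rw [Real.map_volume_mul_left (Real.exp_ne_zero _)]
    exact Measure.smul_absolutelyContinuous
  have hindep : ∀ᵐ H ∂c.lawH, LinearIndependent ℝ H :=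
    ae_linearIndependent volume (by simpa using hn) _ fun i =>
      pi_absolutelyContinuous (hentry i)
  exact hindep.mono fun H hH => eig_pos hH

theorem arrayLaw_le_dilation_add {t : Turbulence} (nR nT : ℕ) {s C : ℝ} (hs : 0 < s) (hC : 0 < C)
    {U : Set ℝ} (hU : MeasurableSet U) (h : ∀ x ∈ U, 0 < x → t.pdf x ≤ C * t.pdf (s * x))
    {S : Set (Fin nR → Fin nT → ℝ)} (hS : MeasurableSet S) :
    t.arrayLaw nR nT S
      ≤ ENNReal.ofReal ((C / s) ^ (nR * nT)) * t.arrayLaw nR nT ((s⁻¹ • ·) ⁻¹' S)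
        + t.arrayLaw nR nT {H | ∃ i j, H i j ∈ Uᶜ} := by
  have hC' : (C / s).toNNReal ≠ 0 := (Real.toNNReal_pos.2 (by positivity)).ne'
  have : SigmaFinite (t.law.map (s⁻¹ • · : ℝ → ℝ)) :=
    (MeasurableEquiv.mulLeft₀ _ (inv_ne_zero hs.ne')).sigmaFinite_map
  have hle := pi_pi_le_smul_map_add (measurable_const_smul s⁻¹) hC'
    (restrict_law_le_smul_map hs hC.le hU h) hS
  rw [Fintype.card_fin, Fintype.card_fin] at hle
  rwa [ENNReal.ofReal_pow (by positivity)]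

theorem hasDilationBound_arrayLaw_logNormal {μl σl : ℝ} (h0 : 0 < σl) (nR nT : ℕ) {s : ℝ}
    (hs : 0 < s) (hs1 : s ≤ 1) :
    HasDilationBound ((Turbulence.logNormal μl σl h0).arrayLaw nR nT) s := by
  have := isFiniteMeasure_law_logNormal (μl := μl) h0
  set t := Turbulence.logNormal μl σl h0
  set e : ℝ := Real.log s / σl ^ 2
  have he : e ≤ 0 := div_nonpos_of_nonpos_of_nonneg (Real.log_nonpos hs.le hs1) (sq_nonneg σl)
  obtain ⟨C₀, hC₀, hpdf⟩ := exists_pdf_logNormal_le_mul (μl := μl) h0 hs hs1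
  obtain ⟨K, hK⟩ := exists_pi_pi_exists_mem_le (ι := Fin nR) (κ := Fin nT) (μ := t.law)
  refine ⟨-e * (nR * nT : ℕ), mul_nonneg (neg_nonneg.2 he) (Nat.cast_nonneg _), fun q hq => ?_⟩
  obtain ⟨C₁, hC₁, htail⟩ := exists_law_logNormal_Iio_le (μl := μl) h0 hq
  refine ⟨(C₀ / s) ^ (nR * nT) + K * C₁, by positivity, fun τ hτ hτ1 S hS => ?_⟩
  have hfactor : (C₀ * τ ^ e / s) ^ (nR * nT)
      = (C₀ / s) ^ (nR * nT) * τ ^ (-(-e * (nR * nT : ℕ))) := by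
    rw [neg_mul, neg_neg, Real.rpow_mul hτ.le, Real.rpow_natCast, ← mul_pow]
    ring
  have hsmall : t.arrayLaw nR nT {H | ∃ i j, H i j ∈ (Set.Ici τ)ᶜ}
      ≤ ENNReal.ofReal (K * C₁ * τ ^ q) := by
    rw [Set.compl_Ici, mul_assoc, ENNReal.ofReal_mul K.coe_nonneg, ENNReal.ofReal_coe_nnreal]
    exact (hK _ measurableSet_Iio).trans (mul_le_mul_right (htail τ hτ hτ1) _)
  refine (arrayLaw_le_dilation_add nR nT hs (C := C₀ * τ ^ e) (by positivity) measurableSet_Ici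
    (fun x hx _ => hpdf τ x hτ hx) hS).trans (add_le_add ?_ (hsmall.trans ?_))
  · rw [hfactor]
    gcongr
    exact le_add_of_nonneg_right (by positivity)
  · gcongr
    exact le_add_of_nonneg_left (by positivity)

theorem hasDilationBound_arrayLaw (t : Turbulence) (nR nT : ℕ) {s : ℝ} (hs : 0 < s)
    (hs1 : s ≤ 1) : HasDilationBound (t.arrayLaw nR nT) s := by
  have of_pdf_le {C : ℝ} (hC : 0 < C) (h : ∀ x, 0 < x → t.pdf x ≤ C * t.pdf (s * x)) :
      HasDilationBound (t.arrayLaw nR nT) s := by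
    refine ⟨0, le_rfl, fun _ _ => ⟨(C / s) ^ (nR * nT), by positivity, fun τ _ _ S hS => ?_⟩⟩
    have hle := arrayLaw_le_dilation_add nR nT hs hC .univ (fun x _ => h x) hS
    simp only [Set.compl_univ, Set.mem_empty_iff_false, exists_false, Set.ofPred_false,
      measure_empty, add_zero] at hle
    rw [neg_zero, Real.rpow_zero, mul_one]
    exact le_add_right hle
  cases t with
  | negExp => exact of_pdf_le one_pos fun x hx => by simpa using pdf_negExp_le hs1 hx.le
  | gammaGamma ρ₁ ρ₂ h0 h1 =>
    exact of_pdf_le (Real.rpow_pos_of_pos hs _) fun x hx => pdf_gammaGamma_le h0 h1 hs hs1 hx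
  | logNormal μl σl h0 => exact hasDilationBound_arrayLaw_logNormal h0 nR nT hs hs1

theorem exists_lawH_dilation_le (c : Channel nR nT) {s : ℝ} (hs : 0 < s) (hs1 : s ≤ 1) {δ N : ℝ}
    (hδ : 0 < δ) (hN : 0 ≤ N) : ∃ C : ℝ, 0 < C ∧ ∀ ρ : ℝ, 1 ≤ ρ →
      ∀ S : Set (Fin nR → Fin nT → ℝ), MeasurableSet S →
        c.lawH S ≤ ENNReal.ofReal (C * ρ ^ δ) * c.lawH ((s⁻¹ • ·) ⁻¹' S)
          + ENNReal.ofReal (C * ρ ^ (-N)) := by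
  obtain ⟨κ, hκ, h⟩ := hasDilationBound_arrayLaw c.turbulence nR nT hs hs1
  set ε : ℝ := δ / (κ + 1)
  have hε : 0 < ε := by positivity
  obtain ⟨C, hC, h⟩ := h (N / ε) (by positivity)
  refine ⟨C, hC, fun ρ hρ S hS => ?_⟩
  have hρ0 : 0 < ρ := one_pos.trans_le hρ
  have hκε : (ρ ^ (-ε)) ^ (-κ) ≤ ρ ^ δ := by
    rw [← Real.rpow_mul hρ0.le]
    refine Real.rpow_le_rpow_of_exponent_le hρ ?_
    have : ε * (κ + 1) = δ := div_mul_cancel₀ _ (by positivity)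
    linarith
  have hNε : (ρ ^ (-ε)) ^ (N / ε) = ρ ^ (-N) := by
    rw [← Real.rpow_mul hρ0.le, neg_mul, mul_div_cancel₀ _ hε.ne']
  have hcomm : c.attenuate ⁻¹' ((s⁻¹ • ·) ⁻¹' S) = (s⁻¹ • ·) ⁻¹' (c.attenuate ⁻¹' S) := by
    ext H
    have : s⁻¹ • c.attenuate H = c.attenuate (s⁻¹ • H) := by
      ext i j
      exact mul_left_comm _ _ _
    simp only [Set.mem_preimage, this]
  have hdil : MeasurableSet ((s⁻¹ • ·) ⁻¹' S) := measurable_const_smul s⁻¹ hS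
  rw [lawH_eq_map_attenuate, Measure.map_apply (measurable_attenuate c) hS,
    Measure.map_apply (measurable_attenuate c) hdil, hcomm]
  refine (h (ρ ^ (-ε)) (Real.rpow_pos_of_pos hρ0 _)
    (Real.rpow_le_one_of_one_le_of_nonpos hρ (by linarith)) _ (measurable_attenuate c hS)).trans ?_
  rw [hNε]
  gcongr

end ChannelLaw

section Exponents

variable {f g : ℝ → ℝ≥0∞}

theorem eventually_mul_rpow_le {a b : ℝ} (hab : a < b) (C : ℝ) :
    ∀ᶠ ρ : ℝ in atTop, C * ρ ^ a ≤ ρ ^ b / 2 := by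
  have hgap : ∀ᶠ ρ : ℝ in atTop, 2 * C ≤ ρ ^ (b - a) :=
    (tendsto_rpow_atTop (sub_pos.2 hab)).eventually_ge_atTop _
  filter_upwards [hgap, eventually_gt_atTop 0] with ρ hgap hρ
  have hsplit : ρ ^ b = ρ ^ (b - a) * ρ ^ a := by rw [← Real.rpow_add hρ, sub_add_cancel]
  have := mul_le_mul_of_nonneg_right hgap (Real.rpow_nonneg hρ.le a)
  linarith

theorem exponent_le_coe_iff {ρ : ℝ} (hρ : 1 < ρ) (b : ℝ) :
    exponent g ρ ≤ (b : EReal) ↔ g ρ ≤ ENNReal.ofReal (ρ ^ b) := by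
  have hlog : 0 < Real.log ρ := Real.log_pos hρ
  have hρ0 : 0 < ρ := one_pos.trans hρ
  rw [exponent, EReal.div_le_iff_le_mul (by exact_mod_cast hlog) (EReal.coe_ne_top _),
    ← ENNReal.log_le_log_iff, ENNReal.log_ofReal_of_pos (Real.rpow_pos_of_pos hρ0 b),
    Real.log_rpow hρ0, ← EReal.coe_mul, mul_comm]

theorem exponent_le_exponent {ρ : ℝ} (hρ : 1 ≤ ρ) (h : f ρ ≤ g ρ) :
    exponent f ρ ≤ exponent g ρ :=
  EReal.div_le_div_right_of_nonneg (by exact_mod_cast Real.log_nonneg hρ) (ENNReal.log_le_log h)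

theorem exponent_osnrPow {ρ : ℝ} (hρ : 1 < ρ) (e : EReal) :
    exponent (fun ρ => osnrPow ρ e) ρ = e := by
  have hlog : 0 < Real.log ρ := Real.log_pos hρ
  rw [exponent, osnrPow, EReal.log_exp, ← EReal.mul_div_right,
    EReal.div_mul_cancel (EReal.coe_ne_bot _) (EReal.coe_ne_top _) (by exact_mod_cast hlog.ne')]

theorem limsup_exponent_le {L : EReal}
    (h : ∀ b : ℝ, L < b → ∀ᶠ ρ in atTop, f ρ ≤ ENNReal.ofReal (ρ ^ b)) :
    limsup (exponent f) atTop ≤ L := by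
  refine EReal.le_of_forall_lt_iff_le.1 fun b hb => limsup_le_of_le (by isBoundedDefault) ?_
  filter_upwards [h b hb, eventually_gt_atTop 1] with ρ hle hρ
  exact (exponent_le_coe_iff hρ b).2 hle

theorem eventually_le_rpow {b : ℝ} (h : limsup (exponent g) atTop < b) :
    ∀ᶠ ρ in atTop, g ρ ≤ ENNReal.ofReal (ρ ^ b) := by
  filter_upwards [eventually_lt_of_limsup_lt h, eventually_gt_atTop 1] with ρ hlt hρ
  exact (exponent_le_coe_iff hρ b).1 hlt.le

theorem limsup_exponent_le_limsup_exponent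
    (h : ∀ δ N : ℝ, 0 < δ → 0 < N → ∃ C : ℝ, 0 < C ∧ ∀ᶠ ρ in atTop,
      f ρ ≤ ENNReal.ofReal (C * ρ ^ δ) * g ρ + ENNReal.ofReal (C * ρ ^ (-N))) :
    limsup (exponent f) atTop ≤ limsup (exponent g) atTop := by
  refine limsup_exponent_le fun b hb => ?_
  obtain ⟨b', hb', hbb⟩ := EReal.lt_iff_exists_real_btwn.1 hb
  have hbb' : b' < b := by exact_mod_cast hbb
  obtain ⟨C, hC, hfg⟩ := h ((b - b') / 2) (|b| + 1) (by linarith) (by positivity)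
  filter_upwards [hfg, eventually_le_rpow hb', eventually_gt_atTop 0,
    eventually_mul_rpow_le (show (b - b') / 2 + b' < b by linarith) C,
    eventually_mul_rpow_le (show -(|b| + 1) < b by linarith [neg_abs_le b]) C]
    with ρ hfg hg hρ hmain herror
  calc f ρ
      ≤ ENNReal.ofReal (C * ρ ^ ((b - b') / 2)) * g ρ
          + ENNReal.ofReal (C * ρ ^ (-(|b| + 1))) := hfg
    _ ≤ ENNReal.ofReal (C * ρ ^ ((b - b') / 2)) * ENNReal.ofReal (ρ ^ b')
          + ENNReal.ofReal (C * ρ ^ (-(|b| + 1))) := by gcongr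
    _ = ENNReal.ofReal (C * ρ ^ ((b - b') / 2 + b') + C * ρ ^ (-(|b| + 1))) := by
        rw [← ENNReal.ofReal_mul (by positivity), mul_assoc, ← Real.rpow_add hρ,
          ← ENNReal.ofReal_add (by positivity) (by positivity)]
    _ ≤ ENNReal.ofReal (ρ ^ b) := ENNReal.ofReal_le_ofReal (by linarith)

theorem limsup_exponent_add_le {L : EReal} (hf : limsup (exponent f) atTop ≤ L)
    (hg : limsup (exponent g) atTop ≤ L) :
    limsup (exponent fun ρ => f ρ + g ρ) atTop ≤ L := by
  refine limsup_exponent_le fun b hb => ?_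
  obtain ⟨b', hb', hbb⟩ := EReal.lt_iff_exists_real_btwn.1 hb
  have hbb' : b' < b := by exact_mod_cast hbb
  filter_upwards [eventually_le_rpow (hf.trans_lt hb'), eventually_le_rpow (hg.trans_lt hb'),
    eventually_gt_atTop 0, eventually_mul_rpow_le hbb' 1] with ρ hf hg hρ hhalf
  calc f ρ + g ρ ≤ ENNReal.ofReal (ρ ^ b') + ENNReal.ofReal (ρ ^ b') := add_le_add hf hg
    _ = ENNReal.ofReal (ρ ^ b' + ρ ^ b') :=
        (ENNReal.ofReal_add (by positivity) (by positivity)).symm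
    _ ≤ ENNReal.ofReal (ρ ^ b) := ENNReal.ofReal_le_ofReal (by linarith)

theorem max_le_liminf_exponent_osnrPow_add (e₁ e₂ : EReal) :
    max e₁ e₂ ≤ liminf (exponent fun ρ => osnrPow ρ e₁ + osnrPow ρ e₂) atTop := by
  refine le_liminf_of_le (by isBoundedDefault) ?_
  filter_upwards [eventually_gt_atTop 1] with ρ hρ
  exact max_le
    ((exponent_osnrPow hρ e₁).symm.le.trans (exponent_le_exponent hρ.le le_self_add))
    ((exponent_osnrPow hρ e₂).symm.le.trans (exponent_le_exponent hρ.le le_add_self))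

end Exponents

section UnionBoundExponent

variable {nR nT : ℕ} {ρ : ℝ} {H : Fin nR → Fin nT → ℝ}

theorem max_zero_two_sub_expo_le (hρ : 1 < ρ) {i : Fin nR} (hi : 0 < eig H i) :
    max 0 (2 - expo ρ H i) ≤ Real.logb ρ (1 + ρ ^ 2 * eig H i) := by
  have hpos : 0 < ρ ^ 2 * eig H i := by positivity
  refine max_le (Real.logb_nonneg hρ (by linarith)) ?_
  have hexpo : 2 - expo ρ H i = Real.logb ρ (ρ ^ 2 * eig H i) := by
    rw [Real.logb_mul (by positivity) hi.ne', Real.logb_pow, Real.logb_self_eq_one hρ, expo]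
    push_cast
    ring
  rw [hexpo]
  exact Real.logb_le_logb_of_le hρ hpos (by linarith)

theorem sum_max_zero_two_sub_expo_le (hρ : 1 < ρ) (hH : ∀ i, 0 < eig H i) :
    ∑ i, max 0 (2 - expo ρ H i) ≤ Real.logb ρ (gramDet ρ H) := by
  have hfactor (i : Fin nR) : 1 + ρ ^ 2 * eig H i ≠ 0 := by
    have := hH i
    positivity
  rw [gramDet_eq_prod, Real.logb_prod _ _ fun i _ => hfactor i]
  exact Finset.sum_le_sum fun i _ => max_zero_two_sub_expo_le hρ (hH i)

theorem rpow_mul_div_sqrt_gramDet_pow_le {l : ℕ} {C r : ℝ} (hC : 0 ≤ C) (hρ : 1 < ρ)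
    (hH : ∀ i, 0 < eig H i) :
    ρ ^ (l * r) * (C / √(gramDet ρ H)) ^ l
      ≤ C ^ l * ρ ^ (-((l : ℝ) / 2) * (∑ i, max 0 (2 - expo ρ H i) - 2 * r)) := by
  have hρ0 : 0 < ρ := one_pos.trans hρ
  have hD : 0 < gramDet ρ H := gramDet_pos ρ H
  have hpow : (√(gramDet ρ H))⁻¹ ^ l = ρ ^ (-((l : ℝ) / 2) * Real.logb ρ (gramDet ρ H)) := by
    rw [mul_comm, Real.rpow_mul hρ0.le, Real.rpow_logb hρ0 hρ.ne' hD, Real.sqrt_eq_rpow,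
      ← Real.rpow_neg hD.le, ← Real.rpow_natCast, ← Real.rpow_mul hD.le]
    congr 1
    ring
  rw [div_eq_mul_inv, mul_pow, hpow, mul_left_comm, ← Real.rpow_add hρ0]
  gcongr
  · exact hρ.le
  · have hl : (0 : ℝ) ≤ (l : ℝ) / 2 := by positivity
    linarith [mul_le_mul_of_nonneg_left (sum_max_zero_two_sub_expo_le hρ hH) hl]

theorem rpow_mul_lintegral_compl_le_teIntegral (c : Channel nR nT) (hn : nR ≤ nT) {l : ℕ}
    {m r C : ℝ} (hC : 0 ≤ C) (hρ : 1 < ρ) {S : Set (Fin nR → Fin nT → ℝ)}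
    (hS : c.outageSet m r ρ ⊆ S) :
    ENNReal.ofReal (ρ ^ (l * r))
        * ∫⁻ H in Sᶜ, ENNReal.ofReal ((C / √(gramDet ρ H)) ^ l) ∂c.lawH
      ≤ ENNReal.ofReal (C ^ l) * c.teIntegral l m r ρ := by
  have : 0 < ρ := one_pos.trans hρ
  rw [← lintegral_const_mul' _ _ ENNReal.ofReal_ne_top, Channel.teIntegral,
    ← lintegral_const_mul' _ _ ENNReal.ofReal_ne_top]
  refine (lintegral_mono_set (Set.compl_subset_compl.2 hS)).trans (lintegral_mono_ae ?_)
  filter_upwards [ae_restrict_of_ae (ae_eig_pos c hn)] with H hH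
  rw [← ENNReal.ofReal_mul (by positivity), ← ENNReal.ofReal_mul (by positivity)]
  exact ENNReal.ofReal_le_ofReal (rpow_mul_div_sqrt_gramDet_pow_le hC hρ hH)

end UnionBoundExponent

section Outage

variable {nR nT : ℕ}

theorem outageSet_eq_empty (c : Channel nR nT) (m : ℝ) {r ρ : ℝ} (hr : r ≤ 0) (hρ : 1 ≤ ρ) :
    c.outageSet m r ρ = ∅ := by
  have hrate : rate r ρ = 0 :=
    ENNReal.ofReal_of_nonpos (mul_nonpos_of_nonpos_of_nonneg hr (Real.log_nonneg hρ))
  simp only [Channel.outageSet, hrate, not_lt_zero, Set.ofPred_false]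

theorem exists_outageSet_subset (c : Channel nR nT) (m : ℝ) :
    ∃ K : ℝ, ∀ r ρ, 0 < ρ →
      c.outageSet m r ρ ⊆ {H | Real.log (gramDet ρ H) < 2 * (r * Real.log ρ + K)} := by
  obtain ⟨K, hK⟩ := exists_le_mutualInfo_teInput c m
  refine ⟨K, fun r ρ hρ H (hH : c.mutualInfo (c.teInput m ρ) H < rate r ρ) => ?_⟩
  have hlt := (ENNReal.ofReal_lt_ofReal_iff'.1 ((hK ρ hρ H).trans_lt hH)).1
  change Real.log (gramDet ρ H) < 2 * (r * Real.log ρ + K)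
  linarith

theorem log_gramDet_le_max {s : ℝ} (hs : 0 < s) (hs1 : s ≤ 1) (ρ : ℝ) (H : Fin nR → Fin nT → ℝ) :
    Real.log (gramDet ρ H)
      ≤ max (nR * Real.log 2) (Real.log 2 + 2 * Real.log s + Real.log (gramDet ρ (s⁻¹ • H))) := by
  have hle := gramDet_mul_le (s⁻¹ * ρ) (pow_le_one₀ hs.le hs1 : s ^ 2 ≤ 1) H
  rw [mul_inv_cancel_left₀ hs.ne', ← gramDet_smul] at hle
  rcases le_max_iff.1 hle with hle | hle
  · refine le_max_of_le_left ((Real.log_le_log (gramDet_pos ρ H) hle).trans_eq ?_)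
    exact Real.log_pow _ _
  · refine le_max_of_le_right ((Real.log_le_log (gramDet_pos ρ H) hle).trans_eq ?_)
    rw [Real.log_mul (by positivity) (gramDet_pos _ _).ne',
      Real.log_mul two_ne_zero (by positivity), Real.log_pow]
    push_cast
    ring

theorem exists_lawH_preimage_smul_le_Pout (c : Channel nR nT) {r : ℝ} (hr : 0 < r) (K : ℝ) :
    ∃ s : ℝ, 0 < s ∧ s ≤ 1 ∧ ∀ᶠ ρ in atTop,
      c.lawH ((s⁻¹ • ·) ⁻¹' {H | Real.log (gramDet ρ H) < 2 * (r * Real.log ρ + K)})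
        ≤ c.Pout r ρ := by
  obtain ⟨K', hK'⟩ := exists_mutualInfo_le c
  have hlog2 : 0 < Real.log 2 := Real.log_pos one_lt_two
  have hlarge : ∀ᶠ ρ : ℝ in atTop, nR * Real.log 2 / 2 + K' ≤ r * Real.log ρ :=
    (Real.tendsto_log_atTop.const_mul_atTop hr).eventually_ge_atTop _
  refine ⟨Real.exp (-(|K + K'| + Real.log 2)), Real.exp_pos _,
    Real.exp_le_one_iff.2 (neg_nonpos.2 (by positivity)), ?_⟩
  filter_upwards [eventually_gt_atTop 0, hlarge] with ρ hρ hlarge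
  refine le_iInf₂ fun p hp => measure_mono fun H hH => ?_
  refine (hK' ρ hρ p hp H).trans (ENNReal.ofReal_le_ofReal ?_)
  rcases le_max_iff.1 (log_gramDet_le_max (Real.exp_pos (-(|K + K'| + Real.log 2)))
    (Real.exp_le_one_iff.2 (neg_nonpos.2 (by positivity))) ρ H) with hle | hle
  · linarith
  · rw [Real.log_exp] at hle
    have hsmall := Set.mem_preimage.1 hH
    rw [Set.mem_ofPred_eq] at hsmall
    linarith [le_abs_self (K + K')]

end Outage

section RandomCoding

variable {nR nT : ℕ}

theorem exists_Pe_le_of_rate_nonpos (c : Channel nR nT) (hn : nR ≤ nT) (l : ℕ) (m : ℝ) {r : ℝ}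
    (hr : r ≤ 0) : ∃ C : ℝ, 0 < C ∧ ∀ ρ, 1 < ρ →
      ∀ dec : Decoder nR nT l (codeSize l r ρ), c.IsML dec →
        c.Pe l m r ρ dec ≤ ENNReal.ofReal C * c.teIntegral l m r ρ := by
  obtain ⟨C, hC, hPe⟩ := exists_Pe_le c l m
  refine ⟨C ^ l, by positivity, fun ρ hρ dec hdec => ?_⟩
  have hle := hPe ρ (one_pos.trans hρ) r dec hdec ∅ .empty
  rw [measure_empty, zero_add] at hle
  exact hle.trans (rpow_mul_lintegral_compl_le_teIntegral c hn hC.le hρ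
    (outageSet_eq_empty c m hr hρ.le).subset)

theorem exists_Pe_le_of_rate_pos (c : Channel nR nT) (hn : nR ≤ nT) (l : ℕ) (m : ℝ) {r : ℝ}
    (hr : 0 < r) {δ N : ℝ} (hδ : 0 < δ) (hN : 0 ≤ N) :
    ∃ C₁ C₂ : ℝ, 0 < C₁ ∧ 0 < C₂ ∧ ∀ᶠ ρ in atTop,
      ∀ dec : Decoder nR nT l (codeSize l r ρ), c.IsML dec →
        c.Pe l m r ρ dec
          ≤ ENNReal.ofReal (C₁ * ρ ^ δ) * c.Pout r ρ + ENNReal.ofReal (C₁ * ρ ^ (-N))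
            + ENNReal.ofReal C₂ * c.teIntegral l m r ρ := by
  obtain ⟨C, hC, hPe⟩ := exists_Pe_le c l m
  obtain ⟨K, hout⟩ := exists_outageSet_subset c m
  obtain ⟨s, hs, hs1, hPout⟩ := exists_lawH_preimage_smul_le_Pout c hr K
  obtain ⟨C₁, hC₁, hdil⟩ := exists_lawH_dilation_le c hs hs1 hδ hN
  refine ⟨C₁, C ^ l, hC₁, by positivity, ?_⟩
  filter_upwards [eventually_gt_atTop 1, hPout] with ρ hρ hPout dec hdec
  set S : Set (Fin nR → Fin nT → ℝ) := {H | Real.log (gramDet ρ H) < 2 * (r * Real.log ρ + K)}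
  have hS : MeasurableSet S :=
    measurableSet_lt (Real.measurable_log.comp (continuous_gramDet ρ).measurable) measurable_const
  calc c.Pe l m r ρ dec
      ≤ c.lawH S + ENNReal.ofReal (ρ ^ (l * r))
          * ∫⁻ H in Sᶜ, ENNReal.ofReal ((C / √(gramDet ρ H)) ^ l) ∂c.lawH :=
        hPe ρ (one_pos.trans hρ) r dec hdec S hS
    _ ≤ ENNReal.ofReal (C₁ * ρ ^ δ) * c.lawH ((s⁻¹ • ·) ⁻¹' S) + ENNReal.ofReal (C₁ * ρ ^ (-N))
          + ENNReal.ofReal (C ^ l) * c.teIntegral l m r ρ :=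
        add_le_add (hdil ρ hρ.le S hS)
          (rpow_mul_lintegral_compl_le_teIntegral c hn hC.le hρ (hout r ρ (one_pos.trans hρ)))
    _ ≤ _ := by gcongr

theorem exists_Pe_le_Pout_add_teIntegral (c : Channel nR nT) (hn : nR ≤ nT) (l : ℕ) (m r : ℝ)
    {δ N : ℝ} (hδ : 0 < δ) (hN : 0 ≤ N) : ∃ C : ℝ, 0 < C ∧ ∀ᶠ ρ in atTop,
      ∀ dec : Decoder nR nT l (codeSize l r ρ), c.IsML dec → c.Pe l m r ρ dec ≤
        ENNReal.ofReal (C * ρ ^ δ) * (c.Pout r ρ + c.teIntegral l m r ρ)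
          + ENNReal.ofReal (C * ρ ^ (-N)) := by
  rcases le_or_gt r 0 with hr | hr
  · obtain ⟨C, hC, hPe⟩ := exists_Pe_le_of_rate_nonpos c hn l m hr
    refine ⟨C, hC, ?_⟩
    filter_upwards [eventually_gt_atTop 1] with ρ hρ dec hdec
    refine (hPe ρ hρ dec hdec).trans (le_add_right (mul_le_mul' ?_ le_add_self))
    exact ENNReal.ofReal_le_ofReal (le_mul_of_one_le_right hC.le (Real.one_le_rpow hρ.le hδ.le))
  · obtain ⟨C₁, C₂, hC₁, hC₂, hPe⟩ := exists_Pe_le_of_rate_pos c hn l m hr hδ hN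
    refine ⟨C₁ + C₂, by positivity, ?_⟩
    filter_upwards [hPe, eventually_gt_atTop 1] with ρ hPe hρ dec hdec
    refine (hPe dec hdec).trans ?_
    have : 0 < ρ := one_pos.trans hρ
    have hC₂' : C₂ ≤ (C₁ + C₂) * ρ ^ δ :=
      (le_add_of_nonneg_left hC₁.le).trans
        (le_mul_of_one_le_right (by positivity) (Real.one_le_rpow hρ.le hδ.le))
    have hC₁' : C₁ ≤ C₁ + C₂ := le_add_of_nonneg_right hC₂.le
    rw [mul_add, add_right_comm]
    gcongr

end RandomCoding

end OWC

theorem mainTheorem5_general {nR nT l : ℕ} (hn : nR ≤ nT) (c : OWC.Channel nR nT) (m r : ℝ)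
    (δ : ∀ ρ : ℝ, OWC.Decoder nR nT l (OWC.codeSize l r ρ)) (hδ : ∀ ρ, c.IsML (δ ρ)) :
    limsup (OWC.exponent fun ρ => c.Pe l m r ρ (δ ρ)) atTop ≤
        limsup (OWC.exponent fun ρ => c.Pout r ρ + c.teIntegral l m r ρ) atTop ∧
      ∀ dout dte : EReal,
        OWC.ExpEq (c.Pout r) (-dout) → OWC.ExpEq (c.teIntegral l m r) (-dte) →
          OWC.ExpLE (fun ρ => c.Pe l m r ρ (δ ρ))
            (fun ρ => OWC.osnrPow ρ (-dout) + OWC.osnrPow ρ (-dte)) := by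
  have hlimsup : limsup (OWC.exponent fun ρ => c.Pe l m r ρ (δ ρ)) atTop ≤
      limsup (OWC.exponent fun ρ => c.Pout r ρ + c.teIntegral l m r ρ) atTop := by
    refine OWC.limsup_exponent_le_limsup_exponent fun ε N hε hN => ?_
    obtain ⟨C, hC, hPe⟩ := OWC.exists_Pe_le_Pout_add_teIntegral c hn l m r hε hN.le
    exact ⟨C, hC, hPe.mono fun ρ hρ => hρ (δ ρ) (hδ ρ)⟩
  refine ⟨hlimsup, fun dout dte hout hte => ?_⟩
  have hsum : limsup (OWC.exponent fun ρ => c.Pout r ρ + c.teIntegral l m r ρ) atTop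
      ≤ max (-dout) (-dte) :=
    OWC.limsup_exponent_add_le (hout.limsup_eq.le.trans (le_max_left _ _))
      (hte.limsup_eq.le.trans (le_max_right _ _))
  exact hlimsup.trans (hsum.trans (OWC.max_le_liminf_exponent_osnrPow_add _ _))

theorem mainTheorem5 {nR nT l : ℕ} (hnR : 0 < nR) (hn : nR ≤ nT) (hl : 0 < l)
    (c : OWC.Channel nR nT) (m : ℝ) (hm : OWC.truncExpMean m = c.α / nT)
    (r : ℝ) (hr : 0 ≤ r)
    (δ : ∀ ρ : ℝ, OWC.Decoder nR nT l (OWC.codeSize l r ρ)) (hδ : ∀ ρ, c.IsML (δ ρ)) :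
    limsup (OWC.exponent fun ρ => c.Pe l m r ρ (δ ρ)) atTop ≤
        limsup (OWC.exponent fun ρ => c.Pout r ρ + c.teIntegral l m r ρ) atTop ∧
      ∀ dout dte : EReal,
        OWC.ExpEq (c.Pout r) (-dout) → OWC.ExpEq (c.teIntegral l m r) (-dte) →
          OWC.ExpLE (fun ρ => c.Pe l m r ρ (δ ρ))
            (fun ρ => OWC.osnrPow ρ (-dout) + OWC.osnrPow ρ (-dte)) :=
  mainTheorem5_general hn c m r δ hδ
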